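/- Let $d\ge 1$. For $n\ge 1$, the Activated Random Walk (ARW) model with sleep rate $\lambda>0$ on the torus $(\mathbb{Z}/n\mathbb{Z})^d$ is the following continuous-time Markov process. Each site is empty, or contains finitely many active particles, or contains exactly one sleeping particle. Each active particle carries two independent Poisson clocks, independent of those of the other particles: a jump clock of rate $1$ and a sleep clock of rate $\lambda$. When its jump clock rings, the particle jumps from its site $x$ to a uniformly chosen one of the $2d$ sites $x\pm e_i$, $1\le i\le d$ (taken modulo $n$). When its sleep clock rings, it falls asleep if it is alone on its site, and nothing happens otherwise. A sleeping particle does not move, and it becomes active again as soon as an active particle arrives on its site. A configuration is stable if it contains no active particle, and the fixation time $\mathcal{T}_n\in[0,\infty]$ is the first time at which the configuration is stable ($\infty$ if there is none). Let $\mathbb{P}_\mu^\lambda$ be the law of this process when it starts from independent Poisson numbers, with mean $\mu$, of active particles on the sites, and no sleeping particles. There is a constant $\kappa_d>0$, depending only on $d$, such that for all $\mu\in(0,1)$ and $\lambda>0$ with $$\kappa_d\,(2d\lambda)^{\mu}\;<\;\mu^{\mu}(1-\mu)^{1-\mu},$$ there is $c>0$ such that, for every $n\ge 1$, $$\mathbb{P}_\mu^\lambda\Big(\mathcal{T}_n<e^{cn^d}\Big)\;<\;e^{-cn^d}.$$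 -/

import Mathlib

open MeasureTheory ProbabilityTheory
open scoped NNReal ENNReal

namespace ARW

/-- The discrete torus `(ℤ/nℤ)^d`. -/
abbrev Torus (d n : ℕ) : Type := Fin d → ZMod n

/-- The content of a site: `active k` stands for `k` active particles (so `active 0` is an empty
site) and `sleeping` for exactly one sleeping particle. -/
inductive SiteState : Type
  | active (k : ℕ)
  | sleeping

namespace SiteState

/-- The number of active particles on a site. -/
def numActive : SiteState → ℕ
  | active k => k
  | sleeping => 0

/-- One active particle leaves the site. -/
def remove : SiteState → SiteState
  | active k => active (k - 1)
  | sleeping => sleeping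

/-- One active particle arrives on the site; a sleeping particle present there wakes up. -/
def add : SiteState → SiteState
  | active k => active (k + 1)
  | sleeping => active 2

/-- A sleep clock rings on the site: an active particle falls asleep if and only if it is alone. -/
def trySleep : SiteState → SiteState
  | active 1 => sleeping
  | s => s

instance : MeasurableSpace SiteState := ⊤

instance : DiscreteMeasurableSpace SiteState := ⟨fun _ => trivial⟩

instance : Countable SiteState :=
  Function.Injective.countable
    (f := fun s : SiteState => match s with
      | active k => k + 1
      | sleeping => 0)
    (by rintro (a | _) (b | _) h <;> simp_all)

end SiteState

/-- Particle configurations on the torus. -/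
abbrev Config (d n : ℕ) : Type := Torus d n → SiteState

/-- A configuration is stable if it contains no active particle. -/
def Stable {d n : ℕ} (η : Config d n) : Prop := ∀ x, (η x).numActive = 0

/-- What an active particle does when one of its clocks rings: `none` is a ring of its sleep clock,
and `some (i, s)` is a jump by `s` times the `i`-th unit vector, where `s = ±1`. -/
abbrev Ring (d : ℕ) : Type := Option (Fin d × ℤˣ)

/-- A sleep clock has rate `lam`. A particle jumps at rate `1`, in each of the `2d` directions with
equal probability. -/
noncomputable def clockRate {d : ℕ} (lam : ℝ≥0) : Ring d → ℝ≥0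
  | none => lam
  | some _ => 1 / (2 * d)

/-- The rate at which clocks of a given kind ring among the active particles at `x`. -/
noncomputable def rate {d n : ℕ} (lam : ℝ≥0) (η : Config d n) (e : Torus d n × Ring d) : ℝ≥0 :=
  (η e.1).numActive * clockRate lam e.2

/-- The configuration obtained from `η` when the given clock of an active particle at `x` rings. -/
def apply {d n : ℕ} (η : Config d n) : Torus d n × Ring d → Config d n
  | (x, none) => Function.update η x (η x).trySleep
  | (x, some (i, s)) =>
      let y : Torus d n := x + Pi.single i ((s : ℤ) : ZMod n)
      let η' := Function.update η x (η x).remove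
      Function.update η' y (η' y).add

/-- The total rate at which the clocks of the active particles ring. -/
noncomputable def totalRate {d n : ℕ} [NeZero n] (lam : ℝ≥0) (η : Config d n) : ℝ≥0 :=
  ∑ e, rate lam η e

open Classical in
/-- The law of the configuration after the next ring: each ring occurs with probability proportional
to its rate; if nothing can ring, the configuration does not change. -/
noncomputable def stepLaw {d n : ℕ} [NeZero n] (lam : ℝ≥0) (η : Config d n) :
    Measure (Config d n) :=
  if totalRate lam η = 0 then Measure.dirac η
  else ∑ e, (rate lam η e / totalRate lam η) • Measure.dirac (apply η e)

instance {d n : ℕ} [NeZero n] (lam : ℝ≥0) (η : Config d n) :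
    IsProbabilityMeasure (stepLaw lam η) := by
  unfold stepLaw
  split_ifs with h
  · infer_instance
  · constructor
    simp only [Measure.coe_finsetSum, Finset.sum_apply, Measure.smul_apply, measure_univ]
    simp only [ENNReal.smul_def, smul_eq_mul, mul_one]
    rw [← ENNReal.ofNNReal_finsetSum, ← Finset.sum_div]
    exact_mod_cast div_self h

/-- The transition kernel of the embedded jump chain. -/
noncomputable def stepKernel (d n : ℕ) [NeZero n] (lam : ℝ≥0) : Kernel (Config d n) (Config d n) :=
  ⟨stepLaw lam, Measurable.of_discrete⟩

instance (d n : ℕ) [NeZero n] (lam : ℝ≥0) : IsMarkovKernel (stepKernel d n lam) :=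
  ⟨fun η => inferInstanceAs (IsProbabilityMeasure (stepLaw lam η))⟩

/-- The initial law: the numbers of particles on the sites are independent Poisson variables with
mean `μ`, and all the particles are active. -/
noncomputable def initialLaw (d n : ℕ) [NeZero n] (μ : ℝ≥0) : Measure (Config d n) :=
  (Measure.pi fun _ : Torus d n => poissonMeasure μ).map fun k x => SiteState.active (k x)

/-- The law of the embedded jump chain, i.e. the Markov chain with transition kernel `stepKernel`
and initial law `initialLaw`. -/
noncomputable def chainLaw (d n : ℕ) [NeZero n] (μ lam : ℝ≥0) : Measure (ℕ → Config d n) :=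
  Kernel.trajMeasure (X := fun _ => Config d n) (initialLaw d n μ) fun k =>
    (stepKernel d n lam).comap
      (fun h : (i : Finset.Iic k) → Config d n => h ⟨k, Finset.mem_Iic.2 le_rfl⟩)
      (measurable_pi_apply _)

/-- The probability measure of the continuous-time activated random walk model on the torus, on the
space of pairs consisting of the successive configurations (the embedded jump chain) and of
independent exponential variables of mean `1`, independent of the chain, which give the holding
times once divided by the total rates. -/
noncomputable def arwLaw (d n : ℕ) [NeZero n] (μ lam : ℝ≥0) :
    Measure ((ℕ → Config d n) × (ℕ → ℝ)) :=
  (chainLaw d n μ lam).prod (Measure.infinitePi fun _ : ℕ => expMeasure 1)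

/-- The time of the `k`-th ring. A holding time with rate `0` is infinite. -/
noncomputable def ringTime {d n : ℕ} [NeZero n] (lam : ℝ≥0) (ω : (ℕ → Config d n) × (ℕ → ℝ))
    (k : ℕ) : ℝ≥0∞ :=
  ∑ j ∈ Finset.range k, ENNReal.ofReal (ω.2 j) / (totalRate lam (ω.1 j) : ℝ≥0∞)

/-- The configuration at time `t` is `η`: it is the `k`-th configuration of the embedded chain when
`t` lies between the `k`-th and the `(k+1)`-th ring. -/
def StateAt {d n : ℕ} [NeZero n] (lam : ℝ≥0) (ω : (ℕ → Config d n) × (ℕ → ℝ)) (t : ℝ≥0∞)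
    (η : Config d n) : Prop :=
  ∃ k, ringTime lam ω k ≤ t ∧ t < ringTime lam ω (k + 1) ∧ ω.1 k = η

/-- The fixation time: the first time at which the configuration is stable (`∞` if there is none). -/
noncomputable def fixationTime {d n : ℕ} [NeZero n] (lam : ℝ≥0)
    (ω : (ℕ → Config d n) × (ℕ → ℝ)) : ℝ≥0∞ :=
  sInf {t | ∃ η, StateAt lam ω t η ∧ Stable η}

end ARW

/-! ### Rings at different sites commute. -/

namespace ARW

namespace SiteState

/-! The number of particles is conserved, so a run that starts from `N` active particles and fixates
ends in `asleepOn A` for some set `A` of `N` sites. The core is a bound, for each fixed `A`, on the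
probability of being in `asleepOn A` after `k` rings: at most `k * C` with `C = (2d)^(n^d) *
lam^(N-1)`.

If the target is `A`, particles that fall asleep off `A` may be woken at once: this commutes with
the dynamics and does not move the target (`toppleOn_wakeOff`, `iterate_stepOp_asleepOn_le`). The
modified dynamics is abelian: the probability `settle` does not depend on which active site is
toppled (`settle_succ`), so a toppling strategy may be chosen.

The sites are ordered along a Hamiltonian path of the torus (`exists_isPath`), and `A` is filled
with sleepers in that order. The strategy topples any active particle that cannot fall asleep beyond
the current front. When there is none, counting shows that every site of `A` holds one particle,
asleep before the front and active after it; the first active one, at `a`, is then toppled. Either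
it sleeps and the front advances, or it jumps, and it may walk back along the path to the last
sleeper `s` and wake it, which needs `pos a - pos s` prescribed jumps. The weights are such that the
gain from sleeping balances the loss from waking (`weight_eq`), so the potential is a
supermartingale up to an error `C` per ring, caused by the first site of `A`. It starts at `0` and
is at least `1` in `asleepOn A` (`one_le_potential`), hence `settleBound` and `settle_le`.

Summing over `A` gives `(n^d).choose N * k * C`. The hypothesis with `κ = 2d` makes `(n^d).choose N
* C` exponentially small for `N` close to `μ n^d` or larger (`exists_entropy_bound`), and a Chernoff
bound excludes smaller `N`. Rings occur at total rate at most `(1 + lam) n^d` when fixation is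
possible, so a time `exp (c n^d)` contains at most exponentially many rings, up to a negligible
probability (`arwLaw_fixationTime_lt_le`). Small `n` are treated separately: with positive
probability there are more particles than sites, and then fixation never occurs. -/

/-- The number of particles on a site, active or sleeping. -/
def count : SiteState → ℕ
  | active k => k
  | sleeping => 1

/-- A sleeping particle is woken up. -/
def wake : SiteState → SiteState
  | active k => active k
  | sleeping => active 1

lemma numActive_pos_iff {s : SiteState} : 0 < s.numActive ↔ ∃ k, s = active (k + 1) := by
  cases s with
  | active k => cases k <;> simp [numActive]
  | sleeping => simp [numActive]

lemma numActive_add_pos (s : SiteState) : 0 < s.add.numActive := by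
  cases s <;> simp [add, numActive]

lemma numActive_wake_pos {s : SiteState} (h : 0 < s.numActive) : 0 < s.wake.numActive := by
  obtain ⟨k, rfl⟩ := numActive_pos_iff.1 h
  simp [wake, numActive]

end SiteState

open SiteState

variable {d n : ℕ}

/-- The site reached from `x` by a jump. -/
def move (x : Torus d n) (e : Fin d × ℤˣ) : Torus d n :=
  x + Pi.single e.1 ((e.2 : ℤ) : ZMod n)

lemma apply_none (η : Config d n) (x z : Torus d n) :
    apply η (x, none) z = if z = x then (η x).trySleep else η z := by
  simp [apply, Function.update_apply]

lemma apply_some (η : Config d n) (x z : Torus d n) (e : Fin d × ℤˣ) :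
    apply η (x, some e) z =
      if z = move x e then (if z = x then (η z).remove.add else (η z).add)
      else if z = x then (η z).remove else η z := by
  obtain ⟨i, s⟩ := e
  simp only [apply, move, Function.update_apply]
  split_ifs <;> simp_all

lemma numActive_apply_pos {η : Config d n} {x y : Torus d n} (hxy : y ≠ x)
    (hy : 0 < (η y).numActive) (r : Ring d) : 0 < (apply η (x, r) y).numActive := by
  cases r with
  | none => simpa [apply_none, hxy] using hy
  | some e =>
    rw [apply_some]
    split_ifs
    exact numActive_add_pos _
    exact hy

lemma numActive_apply_move_pos (η : Config d n) (x : Torus d n) (e : Fin d × ℤˣ) :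
    0 < (apply η (x, some e) (move x e)).numActive := by
  rw [apply_some, if_pos rfl]
  split_ifs <;> exact numActive_add_pos _

/-- Abelian property: rings at different sites commute. -/
lemma apply_comm {η : Config d n} {x y : Torus d n} (hxy : x ≠ y)
    (hx : 0 < (η x).numActive) (hy : 0 < (η y).numActive) (r q : Ring d) :
    apply (apply η (x, r)) (y, q) = apply (apply η (y, q)) (x, r) := by
  obtain ⟨k, hk⟩ := numActive_pos_iff.1 hx
  obtain ⟨l, hl⟩ := numActive_pos_iff.1 hy
  funext z
  by_cases hzx : z = x
  · subst hzx
    rcases r with _ | e <;> rcases q with _ | f <;>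
      simp only [apply_none, apply_some, hxy, hxy.symm, if_true, if_false, hk] <;>
      (try generalize move y f = b) <;>
      (try generalize move z e = a) <;> (try generalize move z f = b) <;>
      rcases k with _ | k <;> split_ifs <;> simp_all [remove, add, trySleep]
  · by_cases hzy : z = y
    · subst hzy
      rcases r with _ | e <;> rcases q with _ | f <;>
        simp only [apply_none, apply_some, hxy, hxy.symm, if_true, if_false, hl] <;>
        (try generalize move x e = a) <;>
      (try generalize move z e = a) <;> (try generalize move z f = b) <;>
      rcases l with _ | l <;> split_ifs <;> simp_all [remove, add, trySleep]
    · rcases r with _ | e <;> rcases q with _ | f <;>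
        simp only [apply_none, apply_some, hzx, hzy, if_false] <;>
        split_ifs <;> simp_all

/-! ### The dynamics in which particles may only sleep on a prescribed set. -/

/-- The configuration obtained by waking up the particles which sleep off `A`. -/
def wakeOff (A : Finset (Torus d n)) (η : Config d n) : Config d n :=
  fun x => if x ∈ A then η x else (η x).wake

/-- The effect of a ring when particles may only sleep on `A`. -/
def toppleOn (A : Finset (Torus d n)) (η : Config d n) (e : Torus d n × Ring d) : Config d n :=
  wakeOff A (apply η e)

lemma numActive_wakeOff_pos (A : Finset (Torus d n)) {η : Config d n} {x : Torus d n}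
    (h : 0 < (η x).numActive) : 0 < (wakeOff A η x).numActive := by
  unfold wakeOff
  split_ifs
  exacts [h, numActive_wake_pos h]

/-- An arrival on a sleeper gives two active particles whether or not the sleeper was woken
beforehand. Activity of `x` is needed: nothing leaves a sleeping site, whereas the woken particle
would jump. -/
lemma toppleOn_wakeOff (A : Finset (Torus d n)) {η : Config d n} {x : Torus d n}
    (hx : 0 < (η x).numActive) (r : Ring d) :
    toppleOn A (wakeOff A η) (x, r) = wakeOff A (apply η (x, r)) := by
  obtain ⟨k, hk⟩ := numActive_pos_iff.1 hx
  funext z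
  by_cases hz : z ∈ A
  · by_cases hzx : z = x
    · subst hzx
      cases r <;> simp [toppleOn, wakeOff, apply_none, apply_some, hz]
    · cases r <;> simp [toppleOn, wakeOff, apply_none, apply_some, hz, hzx]
  · by_cases hzx : z = x
    · subst hzx
      cases r <;> simp [toppleOn, wakeOff, apply_none, apply_some, hz, hk, wake]
    · cases r
      · rcases h : η z <;> simp [toppleOn, wakeOff, apply_none, hz, hzx, h, wake]
      · rcases h : η z <;> simp only [toppleOn, wakeOff, apply_some, hz, hzx, h, wake, if_false]
        all_goals split_ifs <;> simp [add, wake]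

lemma numActive_toppleOn_pos (A : Finset (Torus d n)) {η : Config d n} {x y : Torus d n}
    (hxy : y ≠ x) (hy : 0 < (η y).numActive) (r : Ring d) :
    0 < (toppleOn A η (x, r) y).numActive :=
  numActive_wakeOff_pos A (numActive_apply_pos hxy hy r)

lemma toppleOn_comm (A : Finset (Torus d n)) {η : Config d n} {x y : Torus d n} (hxy : x ≠ y)
    (hx : 0 < (η x).numActive) (hy : 0 < (η y).numActive) (r q : Ring d) :
    toppleOn A (toppleOn A η (x, r)) (y, q) = toppleOn A (toppleOn A η (y, q)) (x, r) := by
  conv_lhs => rw [toppleOn.eq_def A η, toppleOn_wakeOff A (numActive_apply_pos hxy.symm hy r)]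
  conv_rhs => rw [toppleOn.eq_def A η, toppleOn_wakeOff A (numActive_apply_pos hxy hx q)]
  rw [apply_comm hxy hx hy]

/-- The mean of a function of the next ring of an active particle. -/
noncomputable def ringMean (lam : ℝ) (F : Ring d → ℝ) : ℝ :=
  (lam * F none + ∑ e : Fin d × ℤˣ, F (some e) / (2 * d)) / (1 + lam)

lemma ringMean_comm (lam : ℝ) (F : Ring d → Ring d → ℝ) :
    ringMean lam (fun r => ringMean lam (F r)) =
      ringMean lam (fun q => ringMean lam (fun r => F r q)) := by
  simp only [ringMean, ← Finset.sum_div, Finset.sum_add_distrib, ← Finset.mul_sum]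
  rw [Finset.sum_comm (f := fun e e' : Fin d × ℤˣ => F (some e) (some e'))]
  ring

/-- One jump direction is singled out: it will be the step back along the path, the only favourable
one. -/
lemma ringMean_le (hd : 1 ≤ d) {lam : ℝ} (hlam : 0 < lam) {F : Ring d → ℝ} {a b c : ℝ}
    (e₀ : Fin d × ℤˣ) (ha : F none ≤ a) (hb : F (some e₀) ≤ b) (hc : ∀ e, F (some e) ≤ c) :
    ringMean lam F ≤ (lam * a + (1 / (2 * d) * b + (1 - 1 / (2 * d)) * c)) / (1 + lam) := by
  have hd' : (0 : ℝ) < 2 * d := by positivity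
  unfold ringMean
  gcongr
  rw [← Finset.sum_div, ← Finset.add_sum_erase _ _ (Finset.mem_univ e₀)]
  have hsum : ∑ e ∈ Finset.univ.erase e₀, F (some e) ≤ (2 * d - 1) * c := by
    refine (Finset.sum_le_card_nsmul _ _ c fun e _ => hc e).trans_eq ?_
    have hcard : (Finset.univ.erase e₀).card + 1 = 2 * d := by
      rw [Finset.card_erase_add_one (Finset.mem_univ _), Finset.card_univ, Fintype.card_prod,
        Fintype.card_fin, Fintype.card_units_int, mul_comm]
    have : ((Finset.univ.erase e₀).card : ℝ) = 2 * d - 1 := by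
      rw [eq_sub_iff_add_eq]; exact_mod_cast hcard
    rw [nsmul_eq_mul, this]
  rw [div_le_iff₀ hd']
  have : (1 / (2 * d) * b + (1 - 1 / (2 * d)) * c) * (2 * d) = b + (2 * d - 1) * c := by
    field_simp
  rw [this]
  linarith

lemma ringMean_le_of_forall_le (hd : 1 ≤ d) {lam : ℝ} (hlam : 0 < lam) {F : Ring d → ℝ} {c : ℝ}
    (h : ∀ r, F r ≤ c) : ringMean lam F ≤ c := by
  refine (ringMean_le hd hlam (⟨0, hd⟩, 1) (h none) (h _) fun e => h _).trans_eq ?_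
  field_simp
  ring

/-- The stable configuration with sleeping particles exactly on `A`. -/
def asleepOn (A : Finset (Torus d n)) : Config d n :=
  fun x => if x ∈ A then sleeping else active 0

lemma numActive_asleepOn (A : Finset (Torus d n)) (x : Torus d n) :
    (asleepOn A x).numActive = 0 := by
  unfold asleepOn
  split_ifs <;> rfl

open Classical in
/-- The probability to reach `asleepOn A` within `k` rings when particles may only sleep on `A`. -/
noncomputable def settle (lam : ℝ) (A : Finset (Torus d n)) : ℕ → Config d n → ℝ
  | 0, η => if η = asleepOn A then 1 else 0
  | k + 1, η =>
    if h : ∃ x, 0 < (η x).numActive then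
      ringMean lam fun r => settle lam A k (toppleOn A η (h.choose, r))
    else if η = asleepOn A then 1 else 0

lemma settle_zero_of_active (lam : ℝ) (A : Finset (Torus d n)) {η : Config d n} {x : Torus d n}
    (hx : 0 < (η x).numActive) : settle lam A 0 η = 0 := by
  rw [settle, if_neg]
  rintro rfl
  simp [numActive_asleepOn] at hx

lemma settle_of_stable (lam : ℝ) (A : Finset (Torus d n)) {η : Config d n} (h : Stable η) (k : ℕ) :
    settle lam A k η = settle lam A 0 η := by
  cases k with
  | zero => rfl
  | succ k =>
    unfold settle
    exact dif_neg fun ⟨x, hx⟩ => hx.ne' (h x)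

/-- The probability `settle` does not depend on the site which is toppled. -/
lemma settle_succ (lam : ℝ) (A : Finset (Torus d n)) (k : ℕ) {η : Config d n} {x : Torus d n}
    (hx : 0 < (η x).numActive) :
    settle lam A (k + 1) η = ringMean lam fun r => settle lam A k (toppleOn A η (x, r)) := by
  induction k generalizing η x with
  | zero =>
    have h : ∃ x, 0 < (η x).numActive := ⟨x, hx⟩
    rw [settle, dif_pos h]
    by_cases hxy : h.choose = x
    · rw [hxy]
    -- Toppling one of two active sites leaves the other active, so the target is not reached in a
    -- single ring.
    · have h₁ : ∀ r, settle lam A 0 (toppleOn A η (h.choose, r)) = 0 := fun r =>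
        settle_zero_of_active _ _ (numActive_toppleOn_pos A (Ne.symm hxy) hx r)
      have h₂ : ∀ r, settle lam A 0 (toppleOn A η (x, r)) = 0 := fun r =>
        settle_zero_of_active _ _ (numActive_toppleOn_pos A hxy h.choose_spec r)
      simp only [h₁, h₂]
  | succ k ih =>
    have h : ∃ x, 0 < (η x).numActive := ⟨x, hx⟩
    rw [settle, dif_pos h]
    by_cases hxy : h.choose = x
    · rw [hxy]
    · have h₁ : ∀ r, settle lam A (k + 1) (toppleOn A η (h.choose, r)) = _ := fun r =>
        ih (numActive_toppleOn_pos A (Ne.symm hxy) hx r)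
      have h₂ : ∀ r, settle lam A (k + 1) (toppleOn A η (x, r)) = _ := fun r =>
        ih (numActive_toppleOn_pos A hxy h.choose_spec r)
      simp only [h₁, h₂]
      -- Both sites are now toppled on both sides, in opposite orders: the means are exchanged, then
      -- the topplings.
      rw [ringMean_comm]
      simp only [toppleOn_comm A hxy h.choose_spec hx]

end ARW

/-! ### Conservation of particles, creation of sleepers, and the potential. -/

namespace ARW

open SiteState

variable {d n : ℕ}

/-- The total number of particles. -/
def total [NeZero n] (η : Config d n) : ℕ := ∑ x, (η x).count

lemma total_update [NeZero n] (η : Config d n) (x : Torus d n) (s : SiteState) :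
    total (Function.update η x s) + (η x).count = total η + s.count := by
  unfold total
  rw [← Finset.add_sum_erase _ _ (Finset.mem_univ x),
    ← Finset.add_sum_erase _ (fun x => (η x).count) (Finset.mem_univ x)]
  have : ∑ z ∈ Finset.univ.erase x, (Function.update η x s z).count =
      ∑ z ∈ Finset.univ.erase x, (η z).count :=
    Finset.sum_congr rfl fun z hz => by
      rw [Function.update_of_ne (Finset.ne_of_mem_erase hz)]
  rw [this, Function.update_self]
  omega

lemma total_apply [NeZero n] {η : Config d n} {x : Torus d n} (hx : 0 < (η x).numActive)
    (r : Ring d) : total (apply η (x, r)) = total η := by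
  obtain ⟨k, hk⟩ := numActive_pos_iff.1 hx
  cases r with
  | none =>
    have h := total_update η x (η x).trySleep
    have hc : (η x).trySleep.count = (η x).count := by
      rw [hk]; cases k <;> rfl
    have : apply η (x, none) = Function.update η x (η x).trySleep := rfl
    rw [this]
    omega
  | some e =>
    have hadd : ∀ s : SiteState, s.add.count = s.count + 1 := fun s => by cases s <;> rfl
    have h₁ := total_update η x (η x).remove
    set η' := Function.update η x (η x).remove with hη'
    have h₂ := total_update η' (move x e) (η' (move x e)).add
    have hc : (η x).remove.count + 1 = (η x).count := by
      rw [hk]; rfl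
    have : apply η (x, some e) = Function.update η' (move x e) (η' (move x e)).add := rfl
    rw [this]
    rw [hadd] at h₂
    omega

lemma total_wakeOff [NeZero n] (A : Finset (Torus d n)) (η : Config d n) :
    total (wakeOff A η) = total η := by
  refine Finset.sum_congr rfl fun x _ => ?_
  unfold wakeOff
  split_ifs
  · rfl
  · cases η x <;> rfl

lemma wakeOff_wakeOff (A : Finset (Torus d n)) (η : Config d n) :
    wakeOff A (wakeOff A η) = wakeOff A η := by
  funext x
  unfold wakeOff
  split_ifs
  · rfl
  · cases η x <;> rfl

lemma mem_of_wakeOff_eq {A : Finset (Torus d n)} {η : Config d n} (h : wakeOff A η = η)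
    {x : Torus d n} (hx : η x = sleeping) : x ∈ A := by
  by_contra hA
  have := congrFun h x
  simp [wakeOff, hA, hx, wake] at this

lemma wakeOff_eq_of_forall {A : Finset (Torus d n)} {η : Config d n}
    (h : ∀ x, η x = sleeping → x ∈ A) : wakeOff A η = η := by
  funext x
  unfold wakeOff
  split_ifs with hx
  · rfl
  · rcases hs : η x with k | _
    · rfl
    · exact absurd (h x hs) hx

lemma sleeping_of_toppleOn_none {A : Finset (Torus d n)} {η : Config d n} {x z : Torus d n}
    (h : toppleOn A η (x, none) z = sleeping) :
    η z = sleeping ∨ (z = x ∧ x ∈ A ∧ (η x).numActive = 1) := by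
  by_cases hz : z ∈ A
  · simp only [toppleOn, wakeOff, hz, if_true, apply_none] at h
    split_ifs at h with hzx
    · subst hzx
      rcases hk : η z with k | _
      · rcases k with _ | _ | k <;> simp_all [trySleep, numActive]
      · exact Or.inl rfl
    · exact Or.inl h
  · exfalso
    simp only [toppleOn, wakeOff, hz, if_false] at h
    revert h
    cases apply η (x, none) z <;> simp [wake]

lemma sleeping_of_toppleOn_some {A : Finset (Torus d n)} {η : Config d n} {x z : Torus d n}
    {e : Fin d × ℤˣ} (h : toppleOn A η (x, some e) z = sleeping) :
    η z = sleeping ∧ z ≠ move x e := by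
  have h' : apply η (x, some e) z = sleeping := by
    revert h
    unfold toppleOn wakeOff
    split_ifs
    · exact id
    · cases apply η (x, some e) z <;> simp [wake]
  rw [apply_some] at h'
  split_ifs at h' with h₁ h₂ h₃
  · revert h'; cases (η z).remove <;> simp [add]
  · revert h'; cases η z <;> simp [add]
  · refine ⟨?_, h₁⟩
    revert h'; cases η z <;> simp [remove]
  · exact ⟨h', h₁⟩

/-- A particle on its way back along the path between two sites of `A` is thus not disturbed by its
sleep clock. -/
lemma toppleOn_none_of_notMem {A : Finset (Torus d n)} {η : Config d n} (hη : wakeOff A η = η)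
    {x : Torus d n} (hx : x ∉ A) : toppleOn A η (x, none) = η := by
  funext z
  by_cases hzx : z = x
  · subst hzx
    rcases hk : η z with k | _
    · rcases k with _ | _ | k <;> simp [toppleOn, wakeOff, hx, apply_none, hk, trySleep, wake]
    · exact absurd (mem_of_wakeOff_eq hη hk) hx
  · conv_rhs => rw [← hη]
    simp [toppleOn, wakeOff, apply_none, hzx]

/-- If there are as many particles as sites of `A` and all of them sit on `A`, active ones alone on
their site, then there is exactly one particle on each site of `A`. -/
lemma count_eq_one_of_total_eq [NeZero n] {A : Finset (Torus d n)} {η : Config d n}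
    (hη : wakeOff A η = η) (htot : total η = A.card)
    (hact : ∀ x, 0 < (η x).numActive → x ∈ A ∧ (η x).numActive = 1) {a : Torus d n} (ha : a ∈ A) :
    (η a).count = 1 := by
  have hle : ∀ x ∈ Finset.univ, (η x).count ≤ if x ∈ A then 1 else 0 := fun x _ => by
    rcases hs : η x with k | _
    · rcases Nat.eq_zero_or_pos k with rfl | hk
      · simp [count]
      · have := hact x (by simpa [hs, numActive] using hk)
        simp only [hs, numActive] at this
        simp [count, this]
    · simp [count, mem_of_wakeOff_eq hη hs]
  have hsum : ∑ x, (η x).count = ∑ x, if x ∈ A then 1 else 0 := by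
    simpa [total] using htot
  simpa [ha] using (Finset.sum_eq_sum_iff_of_le hle).1 hsum a (Finset.mem_univ a)

/-- An enumeration of the sites in which successive sites are neighbours. -/
structure IsPath (pos : Torus d n → ℕ) : Prop where
  inj : Function.Injective pos
  lt (x : Torus d n) : pos x < n ^ d
  exists_move (x : Torus d n) : 0 < pos x → ∃ e, pos (move x e) + 1 = pos x

/-- The increments of the potential. -/
noncomputable def weight (lam : ℝ) (pos : Torus d n → ℕ) (A : Finset (Torus d n)) (q : ℕ) : ℝ :=
  (2 * d) ^ n ^ d * lam ^ (A.card - 1) * (1 / (2 * d)) ^ q *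
    lam⁻¹ ^ (A.filter fun a => pos a < q).card

/-- The potential of the configurations whose sleeping particles are at positions less than `l`. -/
noncomputable def potential (lam : ℝ) (pos : Torus d n → ℕ) (A : Finset (Torus d n)) (l : ℕ) : ℝ :=
  ∑ a ∈ A.filter fun a => pos a < l, weight lam pos A (pos a)

section potential

variable {lam : ℝ} {pos : Torus d n → ℕ} {A : Finset (Torus d n)}

lemma weight_pos (hd : 1 ≤ d) (hlam : 0 < lam) (q : ℕ) : 0 < weight lam pos A q := by
  have : (0 : ℝ) < d := by exact_mod_cast hd
  unfold weight
  positivity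

lemma potential_nonneg (hd : 1 ≤ d) (hlam : 0 < lam) (l : ℕ) : 0 ≤ potential lam pos A l :=
  Finset.sum_nonneg fun _ _ => (weight_pos hd hlam _).le

lemma potential_succ (hpos : IsPath pos) {s : Torus d n} (hs : s ∈ A) :
    potential lam pos A (pos s + 1) = potential lam pos A (pos s) + weight lam pos A (pos s) := by
  unfold potential
  have : (A.filter fun a => pos a < pos s + 1) = insert s (A.filter fun a => pos a < pos s) := by
    ext a
    simp only [Finset.mem_filter, Finset.mem_insert, Order.lt_add_one_iff, le_iff_lt_or_eq,
      hpos.inj.eq_iff]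
    constructor
    · rintro ⟨h₁, h₂ | h₂⟩
      exacts [Or.inr ⟨h₁, h₂⟩, Or.inl h₂]
    · rintro (rfl | ⟨h₁, h₂⟩)
      exacts [⟨hs, Or.inr rfl⟩, ⟨h₁, Or.inl h₂⟩]
  rw [this, Finset.sum_insert (by simp), add_comm]

lemma potential_congr {l m : ℕ} (hlm : ∀ a ∈ A, pos a < l ↔ pos a < m) :
    potential lam pos A l = potential lam pos A m := by
  unfold potential
  rw [Finset.filter_congr hlm]

/-- The balance that dictates the form of `weight`: for consecutive sites `s`, `a` of `A`, falling
asleep at `a` (rate `lam`) against walking back to `s` by `pos a - pos s` prescribed jumps of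
probability `1/(2d)` each. -/
lemma weight_eq (hlam : 0 < lam) (hpos : IsPath pos) {s a : Torus d n} (hs : s ∈ A)
    (hsa : pos s < pos a) (hgap : ∀ x ∈ A, pos x < pos a → pos x ≤ pos s) :
    lam * weight lam pos A (pos a) =
      weight lam pos A (pos s) * (1 / (2 * d)) ^ (pos a - pos s) := by
  unfold weight
  have : (A.filter fun x => pos x < pos a) = insert s (A.filter fun x => pos x < pos s) := by
    ext x
    simp only [Finset.mem_filter, Finset.mem_insert]
    constructor
    · rintro ⟨h₁, h₂⟩
      rcases (hgap x h₁ h₂).lt_or_eq with h | h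
      exacts [Or.inr ⟨h₁, h⟩, Or.inl (hpos.inj h)]
    · rintro (rfl | ⟨h₁, h₂⟩)
      exacts [⟨hs, hsa⟩, ⟨h₁, h₂.trans hsa⟩]
  rw [this, Finset.card_insert_of_notMem (by simp), pow_succ]
  conv_lhs => rw [← Nat.add_sub_cancel' hsa.le, pow_add]
  field_simp

lemma weight_le (hd : 1 ≤ d) (hlam : 0 < lam) {q : ℕ} (h : ∀ a ∈ A, ¬ pos a < q) :
    weight lam pos A q ≤ (2 * d) ^ n ^ d * lam ^ (A.card - 1) := by
  have hd' : (1 : ℝ) ≤ d := by exact_mod_cast hd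
  unfold weight
  rw [Finset.filter_false_of_mem h]
  simp only [Finset.card_empty, pow_zero, mul_one]
  refine mul_le_of_le_one_right (by positivity) (pow_le_one₀ (by positivity) ?_)
  rw [div_le_one (by positivity)]
  linarith

/-- The last site of `A` suffices: it has `A.card - 1` predecessors, so the powers of `lam` cancel
and its weight is `(2d)^(n^d - pos a)`. This fixes the normalization of `weight`. -/
lemma one_le_potential (hd : 1 ≤ d) (hlam : 0 < lam) (hpos : IsPath pos) (hA : A.Nonempty) {l : ℕ}
    (hl : ∀ a ∈ A, pos a < l) : 1 ≤ potential lam pos A l := by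
  have hd' : (1 : ℝ) ≤ d := by exact_mod_cast hd
  obtain ⟨a, ha, hmax⟩ := A.exists_max_image pos hA
  have hfil : (A.filter fun x => pos x < pos a) = A.erase a := by
    ext x
    simp only [Finset.mem_filter, Finset.mem_erase]
    constructor
    · rintro ⟨h₁, h₂⟩
      exact ⟨by rintro rfl; exact h₂.false, h₁⟩
    · rintro ⟨h₁, h₂⟩
      exact ⟨h₂, (hmax x h₂).lt_of_ne fun h => h₁ (hpos.inj h)⟩
  calc (1 : ℝ) ≤ (2 * d) ^ (n ^ d - pos a) := one_le_pow₀ (by linarith)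
    _ = weight lam pos A (pos a) := by
      unfold weight
      rw [hfil, Finset.card_erase_of_mem ha, ← Nat.sub_add_cancel (hpos.lt a).le, pow_add]
      simp only [Nat.add_sub_cancel, one_div, inv_pow]
      field_simp
    _ ≤ potential lam pos A l :=
      Finset.single_le_sum (f := fun a => weight lam pos A (pos a))
        (fun x _ => (weight_pos hd hlam _).le) (Finset.mem_filter.2 ⟨ha, hl a ha⟩)

end potential

end ARW

/-! ### The toppling strategy and the supermartingale bound. -/

namespace ARW

open SiteState

variable {d n : ℕ}

variable {pos : Torus d n → ℕ} {A : Finset (Torus d n)}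

lemma sleeping_lt_of_active {η : Config d n} {s : Torus d n} (hpos : IsPath pos)
    (hlow : ∀ z, η z = sleeping → pos z ≤ pos s) (hs : 0 < (η s).numActive) (z : Torus d n)
    (hz : η z = sleeping) : pos z < pos s :=
  (hlow z hz).lt_of_ne fun h => by
    rw [hpos.inj h] at hz
    simp [hz, numActive] at hs

lemma numActive_toppleOn_move_pos (η : Config d n) (x : Torus d n) (e : Fin d × ℤˣ) :
    0 < (toppleOn A η (x, some e) (move x e)).numActive :=
  numActive_wakeOff_pos A (numActive_apply_move_pos η x e)

lemma toppleOn_valid [NeZero n] {η : Config d n} {x : Torus d n}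
    (hx : 0 < (η x).numActive) (htot : total η = A.card) (r : Ring d) :
    wakeOff A (toppleOn A η (x, r)) = toppleOn A η (x, r) ∧
      total (toppleOn A η (x, r)) = A.card :=
  ⟨wakeOff_wakeOff A _, by rw [toppleOn, total_wakeOff, total_apply hx, htot]⟩

/-- The two bounds on `settle` which are proved together: one for all configurations whose sleeping
particles are at positions less than `l`, and a sharper one when an active particle is close to the
last position where a particle may sleep. -/
def SettleBound [NeZero n] (lam : ℝ) (pos : Torus d n → ℕ) (A : Finset (Torus d n)) (k : ℕ) :
    Prop :=
  (∀ (η : Config d n) (l : ℕ), wakeOff A η = η → total η = A.card →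
    (∀ z, η z = sleeping → pos z < l) →
    settle lam A k η ≤ potential lam pos A l +
      k * ((2 * d) ^ n ^ d * lam ^ (A.card - 1))) ∧
  ∀ (η : Config d n) (s y : Torus d n), wakeOff A η = η → total η = A.card → s ∈ A →
    (∀ z, η z = sleeping → pos z ≤ pos s) → 0 < (η y).numActive → pos s ≤ pos y →
    (∀ a ∈ A, pos a ≤ pos y → pos a ≤ pos s) →
    settle lam A k η ≤ potential lam pos A (pos s) +
      weight lam pos A (pos s) * (1 - (1 / (2 * d)) ^ (pos y - pos s)) +
      k * ((2 * d) ^ n ^ d * lam ^ (A.card - 1))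

variable [NeZero n] {lam : ℝ}

lemma settle_le_of_stable (hd : 1 ≤ d) (hlam : 0 < lam) (hpos : IsPath pos) (hA : A.Nonempty)
    {η : Config d n} (hst : Stable η) {l : ℕ} (hlow : ∀ z, η z = sleeping → pos z < l) (k : ℕ) :
    settle lam A k η ≤ potential lam pos A l := by
  rw [settle_of_stable lam A hst, settle]
  split_ifs with h
  · subst h
    exact one_le_potential hd hlam hpos hA fun a ha => hlow a (by simp [asleepOn, ha])
  · exact potential_nonneg hd hlam l

lemma settleBound_zero (hd : 1 ≤ d) (hlam : 0 < lam) (hpos : IsPath pos) (hA : A.Nonempty) :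
    SettleBound lam pos A 0 := by
  constructor
  · intro η l _ _ hlow
    rw [Nat.cast_zero, zero_mul, add_zero]
    by_cases hst : Stable η
    · exact settle_le_of_stable hd hlam hpos hA hst hlow 0
    · obtain ⟨x, hx⟩ := not_forall.1 hst
      rw [settle_zero_of_active lam A (Nat.pos_of_ne_zero hx)]
      exact potential_nonneg hd hlam l
  · intro η s y _ _ _ _ hy _ _
    rw [settle_zero_of_active lam A hy, Nat.cast_zero, zero_mul, add_zero]
    have hd' : (1 : ℝ) ≤ d := by exact_mod_cast hd
    refine add_nonneg (potential_nonneg hd hlam _) (mul_nonneg (weight_pos hd hlam _).le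
      (sub_nonneg.2 (pow_le_one₀ (by positivity) ?_)))
    rw [div_le_one (by positivity)]
    linarith

/-- If some active site cannot produce a sleeping particle at a position at least `l`, then it may
be toppled. -/
lemma settle_succ_le_of_harmless (hd : 1 ≤ d) (hlam : 0 < lam) {k : ℕ}
    (hk : SettleBound lam pos A k) {η : Config d n} (htot : total η = A.card) {l : ℕ}
    (hlow : ∀ z, η z = sleeping → pos z < l) {x : Torus d n} (hx : 0 < (η x).numActive)
    (hharm : x ∈ A → (η x).numActive = 1 → pos x < l) :
    settle lam A (k + 1) η ≤ potential lam pos A l +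
      k * ((2 * d) ^ n ^ d * lam ^ (A.card - 1)) := by
  rw [settle_succ lam A k hx]
  refine ringMean_le_of_forall_le hd hlam fun r => ?_
  obtain ⟨h₁, h₂⟩ := toppleOn_valid hx htot r
  refine hk.1 _ l h₁ h₂ fun z hz => ?_
  cases r with
  | none =>
    obtain h | ⟨rfl, h, h'⟩ := sleeping_of_toppleOn_none hz
    exacts [hlow z h, hharm h h']
  | some e => exact hlow z (sleeping_of_toppleOn_some hz).1

/-- The bound when all the sites of `A` are filled, by sleeping particles up to position `l` and by
active particles from there on. -/
lemma settle_succ_le_of_filled (hd : 1 ≤ d) (hlam : 0 < lam) (hpos : IsPath pos) {k : ℕ}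
    (hk : SettleBound lam pos A k) {η : Config d n} (hη : wakeOff A η = η)
    (htot : total η = A.card) {l : ℕ} (hlow : ∀ z, η z = sleeping → pos z < l)
    {a : Torus d n} (ha : a ∈ A) (hact : 0 < (η a).numActive) (hla : l ≤ pos a)
    (hmin : ∀ x ∈ A, l ≤ pos x → pos a ≤ pos x) :
    settle lam A (k + 1) η ≤ potential lam pos A l +
      (k + 1 : ℕ) * ((2 * d) ^ n ^ d * lam ^ (A.card - 1)) := by
  have hd' : (1 : ℝ) ≤ d := by exact_mod_cast hd
  set C : ℝ := (2 * d) ^ n ^ d * lam ^ (A.card - 1) with hC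
  have hC0 : 0 < C := by positivity
  -- There is no site of `A` between `l` and `pos a`.
  have hla' : potential lam pos A l = potential lam pos A (pos a) :=
    potential_congr fun x hx =>
      ⟨fun h => h.trans_le hla, fun h => by_contra fun h' => (hmin x hx (not_lt.1 h')).not_gt h⟩
  rw [settle_succ lam A k hact]
  have hnone : settle lam A k (toppleOn A η (a, none)) ≤
      potential lam pos A l + weight lam pos A (pos a) + k * C := by
    rw [hla', ← potential_succ hpos ha]
    obtain ⟨h₁, h₂⟩ := toppleOn_valid hact htot none
    refine hk.1 _ _ h₁ h₂ fun z hz => ?_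
    obtain h | ⟨rfl, _⟩ := sleeping_of_toppleOn_none hz
    · exact ((hlow z h).trans_le hla).trans (Nat.lt_succ_self _)
    · exact Nat.lt_succ_self _
  have hsome : ∀ e, settle lam A k (toppleOn A η (a, some e)) ≤ potential lam pos A l + k * C := by
    intro e
    obtain ⟨h₁, h₂⟩ := toppleOn_valid hact htot (some e)
    exact hk.1 _ _ h₁ h₂ fun z hz => hlow z (sleeping_of_toppleOn_some hz).1
  -- If a site of `A` precedes `a`, the last such site `s` is the one that the particle at `a` can
  -- try to wake.
  by_cases hS : ∃ s ∈ A, pos s < l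
  · obtain ⟨s₀, hs₀, hs₀l⟩ := hS
    obtain ⟨s, hs, hmax⟩ := (A.filter fun x => pos x < l).exists_max_image pos
      ⟨s₀, Finset.mem_filter.2 ⟨hs₀, hs₀l⟩⟩
    obtain ⟨hsA, hsl⟩ := Finset.mem_filter.1 hs
    have hgap : ∀ x ∈ A, pos x < pos a → pos x ≤ pos s := fun x hx hxa =>
      hmax x (Finset.mem_filter.2 ⟨hx, by_contra fun h => (hmin x hx (not_lt.1 h)).not_gt hxa⟩)
    have hsa : pos s < pos a := hsl.trans_le hla
    have hls : potential lam pos A l = potential lam pos A (pos s) + weight lam pos A (pos s) := by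
      rw [← potential_succ hpos hsA, hla']
      refine potential_congr fun x hx => ⟨fun h => Nat.lt_succ_of_le (hgap x hx h), fun h => ?_⟩
      omega
    obtain ⟨e, he⟩ := hpos.exists_move a (Nat.zero_lt_of_lt hsa)
    have hprev : settle lam A k (toppleOn A η (a, some e)) ≤ potential lam pos A (pos s) +
        weight lam pos A (pos s) * (1 - (1 / (2 * d)) ^ (pos a - pos s - 1)) + k * C := by
      obtain ⟨h₁, h₂⟩ := toppleOn_valid hact htot (some e)
      have := hk.2 _ s (move a e) h₁ h₂ hsA
        (fun z hz => ?_) (numActive_toppleOn_move_pos η a e) (by omega)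
        (fun x hx hxa => hgap x hx (by omega))
      · rwa [show pos (move a e) - pos s = pos a - pos s - 1 by omega] at this
      · have hz' := (sleeping_of_toppleOn_some hz).1
        exact hmax z (Finset.mem_filter.2 ⟨mem_of_wakeOff_eq hη hz', hlow z hz'⟩)
    refine (ringMean_le hd hlam e hnone hprev hsome).trans ?_
    -- The increase `lam * weight (pos a)` from sleeping equals the decrease `weight (pos s) *
    -- (1/(2d))^(pos a - pos s)` from a first jump back followed by the second bound of
    -- `SettleBound`.
    have hw := weight_eq hlam hpos hsA hsa hgap
    have hp : (1 / (2 * (d : ℝ))) ^ (pos a - pos s) =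
        1 / (2 * d) * (1 / (2 * d)) ^ (pos a - pos s - 1) := by
      rw [← pow_succ']; congr 1; omega
    rw [div_le_iff₀ (by positivity), hls]
    push_cast
    rw [hp] at hw
    nlinarith [mul_pos hC0 (by positivity : 0 < 1 + lam)]
  -- With no site of `A` before `a` nothing compensates the increase; it is at most `C` and is
  -- charged to the additional ring.
  · have hw : weight lam pos A (pos a) ≤ C := weight_le hd hlam fun x hx hxa =>
      hS ⟨x, hx, by_contra fun h => (hmin x hx (not_lt.1 h)).not_gt hxa⟩
    refine (ringMean_le hd hlam (⟨0, hd⟩, 1) hnone (hsome _) hsome).trans ?_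
    rw [div_le_iff₀ (by positivity)]
    push_cast
    nlinarith [mul_le_mul_of_nonneg_left hw hlam.le]

/-- The two bounds feed each other: a jump back from the front uses the second, and a walk that
leaves the path or arrives at `s` returns to the first. -/
lemma settleBound_succ (hd : 1 ≤ d) (hlam : 0 < lam) (hpos : IsPath pos) (hA : A.Nonempty) {k : ℕ}
    (hk : SettleBound lam pos A k) : SettleBound lam pos A (k + 1) := by
  have hd' : (1 : ℝ) ≤ d := by exact_mod_cast hd
  have hC0 : 0 < (2 * (d : ℝ)) ^ n ^ d * lam ^ (A.card - 1) := by positivity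
  have first : ∀ (η : Config d n) (l : ℕ), wakeOff A η = η → total η = A.card →
      (∀ z, η z = sleeping → pos z < l) → settle lam A (k + 1) η ≤ potential lam pos A l +
        (k + 1 : ℕ) * ((2 * d) ^ n ^ d * lam ^ (A.card - 1)) := by
    intro η l hη htot hlow
    by_cases hst : Stable η
    · exact (settle_le_of_stable hd hlam hpos hA hst hlow _).trans
        (le_add_of_nonneg_right (by positivity))
    by_cases hharm : ∃ x, 0 < (η x).numActive ∧ (x ∈ A → (η x).numActive = 1 → pos x < l)
    · obtain ⟨x, hx, hx'⟩ := hharm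
      refine (settle_succ_le_of_harmless hd hlam hk htot hlow hx hx').trans ?_
      push_cast
      linarith
    -- Every active particle is now alone, on `A`, and at a position at least `l`. As there are
    -- `A.card` particles, each site of `A` holds exactly one.
    · push Not at hharm
      obtain ⟨x₀, hx₀⟩ := not_forall.1 hst
      obtain ⟨hx₀A, hx₀1, hx₀l⟩ := hharm x₀ (Nat.pos_of_ne_zero hx₀)
      obtain ⟨a, ha, hmin⟩ := (A.filter fun x => l ≤ pos x).exists_min_image pos
        ⟨x₀, Finset.mem_filter.2 ⟨hx₀A, hx₀l⟩⟩
      obtain ⟨haA, hal⟩ := Finset.mem_filter.1 ha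
      have hone := count_eq_one_of_total_eq hη htot (fun x hx =>
        ⟨(hharm x hx).1, (hharm x hx).2.1⟩) haA
      have hact : 0 < (η a).numActive := by
        rcases hs : η a with m | _
        · simp_all [count, numActive]
        · exact absurd (hlow a hs) (not_lt.2 hal)
      exact settle_succ_le_of_filled hd hlam hpos hk hη htot hlow haA hact hal fun x hx hxl =>
        hmin x (Finset.mem_filter.2 ⟨hx, hxl⟩)
  refine ⟨first, ?_⟩
  intro η s y hη htot hs hlow hy hsy hgap
  -- If `y = s`, the walk has arrived: `s` is awake and the front is back at `pos s`. Otherwise `y`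
  -- lies strictly between sites of `A`, and one more step back is attempted.
  rcases hsy.eq_or_lt with heq | hlt
  · rw [heq, Nat.sub_self, pow_zero, sub_self, mul_zero, add_zero, ← heq]
    obtain rfl := hpos.inj heq
    exact first η _ hη htot (sleeping_lt_of_active hpos hlow hy)
  · have hyA : y ∉ A := fun h => (hgap y h le_rfl).not_gt hlt
    obtain ⟨e, he⟩ := hpos.exists_move y (Nat.zero_lt_of_lt hlt)
    rw [settle_succ lam A k hy]
    have hnone := hk.2 η s y hη htot hs hlow hy hsy hgap
    rw [← toppleOn_none_of_notMem hη hyA] at hnone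
    have hlow' : ∀ e z, toppleOn A η (y, some e) z = sleeping → pos z ≤ pos s := fun e z hz =>
      hlow z (sleeping_of_toppleOn_some hz).1
    have hprev := hk.2 _ s (move y e) (toppleOn_valid hy htot (some e)).1
      (toppleOn_valid hy htot (some e)).2 hs (hlow' e) (numActive_toppleOn_move_pos η y e)
      (by omega) (fun x hx hxa => hgap x hx (by omega))
    -- A jump in another direction only loses the chance of waking `s`: the front stays at most at
    -- `pos s + 1`.
    have hsome : ∀ e, settle lam A k (toppleOn A η (y, some e)) ≤ potential lam pos A (pos s) +
        weight lam pos A (pos s) + k * ((2 * d) ^ n ^ d * lam ^ (A.card - 1)) := by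
      intro e
      rw [← potential_succ hpos hs]
      exact hk.1 _ _ (toppleOn_valid hy htot (some e)).1 (toppleOn_valid hy htot (some e)).2
        fun z hz => Nat.lt_succ_of_le (hlow' e z hz)
    refine (ringMean_le hd hlam e hnone hprev hsome).trans ?_
    have hp : (1 / (2 * (d : ℝ))) ^ (pos y - pos s) =
        1 / (2 * d) * (1 / (2 * d)) ^ (pos (move y e) - pos s) := by
      rw [← pow_succ']; congr 1; omega
    rw [div_le_iff₀ (by positivity), hp]
    push_cast
    nlinarith [mul_pos hC0 (by positivity : 0 < 1 + lam)]

theorem settleBound (hd : 1 ≤ d) (hlam : 0 < lam) (hpos : IsPath pos) (hA : A.Nonempty) (k : ℕ) :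
    SettleBound lam pos A k := by
  induction k with
  | zero => exact settleBound_zero hd hlam hpos hA
  | succ k ih => exact settleBound_succ hd hlam hpos hA ih

/-- Without sleepers the front may be put at `l = 0`, where the potential is an empty sum. -/
theorem settle_le (hd : 1 ≤ d) (hlam : 0 < lam) (hpos : IsPath pos) (hA : A.Nonempty) (k : ℕ)
    {η : Config d n} (htot : total η = A.card) (hη : ∀ x, η x ≠ sleeping) :
    settle lam A k η ≤ k * ((2 * d) ^ n ^ d * lam ^ (A.card - 1)) := by
  have := (settleBound hd hlam hpos hA k).1 η 0
    (wakeOff_eq_of_forall fun x hx => absurd hx (hη x)) htot fun z hz => absurd hz (hη z)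
  simpa [potential] using this

end ARW

/-! ### A Hamiltonian path of the torus. -/

namespace ARW

variable {d n : ℕ}

/-- The modular Gray code: the `i`-th coordinate of the `q`-th site is the difference of the `i`-th
and of the `(i+1)`-th digits of `q` in base `n`. -/
def grayCode (d n : ℕ) (q : ℕ) : Torus d n :=
  fun i => ((q / n ^ (i : ℕ) : ℕ) : ZMod n) - ((q / n ^ ((i : ℕ) + 1) : ℕ) : ZMod n)

/-- The quotients by powers of `n` are recovered from the highest, which is `0`: the quotient by
`n^(i+1)` and the `i`-th coordinate determine the quotient by `n^i`. -/
lemma grayCode_injOn [NeZero n] {p q : ℕ} (hp : p < n ^ d) (hq : q < n ^ d)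
    (h : grayCode d n p = grayCode d n q) : p = q := by
  have key : ∀ j ≤ d, p / n ^ (d - j) = q / n ^ (d - j) := by
    intro j
    induction j with
    | zero => intro _; rw [Nat.sub_zero, Nat.div_eq_of_lt hp, Nat.div_eq_of_lt hq]
    | succ j ih =>
      intro hj
      have ih := ih (by omega)
      have hi := congrFun h ⟨d - (j + 1), by omega⟩
      simp only [grayCode, show d - (j + 1) + 1 = d - j by omega, ih, sub_left_inj] at hi
      have hmod : p / n ^ (d - (j + 1)) % n = q / n ^ (d - (j + 1)) % n :=
        (ZMod.natCast_eq_natCast_iff' _ _ _).1 hi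
      rw [show d - j = d - (j + 1) + 1 by omega, pow_succ, ← Nat.div_div_eq_div_mul,
        ← Nat.div_div_eq_div_mul] at ih
      rw [← Nat.div_add_mod (p / n ^ (d - (j + 1))) n, ih, hmod, Nat.div_add_mod]
  simpa using key d le_rfl

/-- The quotient by `n^i` increases exactly when `n^i` divides `q + 1`, that is for `i ≤ j`, where
`j` is the position at which the carry stops. In the differences of consecutive quotients only the
`j`-th changes. -/
lemma grayCode_succ [NeZero n] {q : ℕ} (hq : q + 1 < n ^ d) :
    ∃ i : Fin d, grayCode d n (q + 1) = grayCode d n q + Pi.single i 1 := by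
  have hdvd : ∃ j, ¬ n ^ (j + 1) ∣ q + 1 ∧ j < d := by
    rcases d with _ | d
    · simp at hq
    · exact ⟨d, fun h => (Nat.le_of_dvd (Nat.succ_pos q) h).not_gt hq, Nat.lt_succ_self d⟩
  classical
  set j := Nat.find hdvd with hj
  obtain ⟨hj₁, hj₂⟩ := Nat.find_spec hdvd
  have hlow : ∀ i ≤ j, n ^ i ∣ q + 1 := by
    intro i hi
    rcases i with _ | i
    · simp
    · by_contra h
      exact Nat.find_min hdvd (m := i) hi ⟨h, lt_trans hi hj₂⟩
  have hhigh : ∀ i, j < i → ¬ n ^ i ∣ q + 1 := fun i hi h =>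
    hj₁ ((pow_dvd_pow n hi).trans h)
  refine ⟨⟨j, hj₂⟩, funext fun i => ?_⟩
  simp only [grayCode, Pi.add_apply, Pi.single_apply, Fin.ext_iff, Nat.succ_div]
  rcases lt_trichotomy (i : ℕ) j with h | h | h
  · rw [if_pos (hlow i h.le), if_pos (hlow (i + 1) h), if_neg h.ne]
    push_cast
    ring
  · rw [if_pos (hlow i h.le), if_neg (hhigh (i + 1) (by omega)), if_pos h]
    push_cast
    ring
  · rw [if_neg (hhigh i h), if_neg (hhigh (i + 1) (by omega)), if_neg h.ne']
    push_cast
    ring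

lemma exists_isPath (d n : ℕ) [NeZero n] : ∃ pos : Torus d n → ℕ, IsPath pos := by
  have hinj : Function.Injective fun q : Fin (n ^ d) => grayCode d n q := fun p q h =>
    Fin.ext (grayCode_injOn p.2 q.2 h)
  have hbij : Function.Bijective fun q : Fin (n ^ d) => grayCode d n q :=
    (Fintype.bijective_iff_injective_and_card _).2 ⟨hinj, by simp [ZMod.card]⟩
  set E := Equiv.ofBijective _ hbij
  have hE : ∀ x, grayCode d n (E.symm x) = x := fun x => E.apply_symm_apply x
  refine ⟨fun x => E.symm x, fun x y h => E.symm.injective (Fin.ext h), fun x => (E.symm x).2,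
    fun x hx => ?_⟩
  have hlt := (E.symm x).2
  obtain ⟨i, hi⟩ := grayCode_succ (d := d) (n := n) (q := E.symm x - 1) (by omega)
  rw [Nat.sub_add_cancel hx, hE] at hi
  refine ⟨(i, -1), ?_⟩
  have hmove : move x (i, -1) = E ⟨E.symm x - 1, by omega⟩ := by
    rw [show E ⟨E.symm x - 1, by omega⟩ = grayCode d n (E.symm x - 1) from rfl]
    conv_lhs => rw [hi]
    funext z
    by_cases hz : z = i <;> simp [move, hz]
  rw [hmove, Equiv.symm_apply_apply]
  exact Nat.sub_add_cancel hx

end ARW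

/-! ### From the jump chain to the restricted dynamics, and the union over final sets. -/

namespace ARW

open SiteState

section trajMeasure

open Kernel Preorder

variable {X : ℕ → Type*} [∀ k, MeasurableSpace (X k)] (μ₀ : Measure (X 0)) [IsProbabilityMeasure μ₀]
  (κ : (k : ℕ) → Kernel (Π i : Finset.Iic k, X i) (X (k + 1))) [∀ k, IsMarkovKernel (κ k)]

omit [IsProbabilityMeasure μ₀] in
lemma map_zero_trajMeasure : (trajMeasure μ₀ κ).map (fun x => x 0) = μ₀ := by
  set S := (MeasurableEquiv.piUnique fun i : Finset.Iic 0 => X i).symm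
  have h : (trajMeasure μ₀ κ).map (frestrictLe 0) = μ₀.map S := by
    rw [trajMeasure, Measure.map_comp _ _ (by fun_prop), traj_map_frestrictLe, partialTraj_self,
      Measure.id_comp]
  let ev : (Π i : Finset.Iic 0, X i) → X 0 := fun y => y ⟨0, Finset.mem_Iic.2 le_rfl⟩
  have hev : Measurable ev := measurable_pi_apply _
  calc (trajMeasure μ₀ κ).map (fun x => x 0) = ((trajMeasure μ₀ κ).map (frestrictLe 0)).map ev :=
        (Measure.map_map hev (measurable_frestrictLe 0)).symm
    _ = μ₀ := by
      rw [h]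
      exact (Measure.map_map (μ := μ₀) hev S.measurable).trans Measure.map_id

/-- The whole past is kept in `g`, so that the final configuration can later be compared with the
initial one. -/
lemma lintegral_trajMeasure_succ (k : ℕ) (g : (Π i : Finset.Iic k, X i) × X (k + 1) → ℝ≥0∞)
    (hg : Measurable g) :
    ∫⁻ x, g (frestrictLe k x, x (k + 1)) ∂trajMeasure μ₀ κ =
      ∫⁻ x, ∫⁻ y, g (frestrictLe k x, y) ∂κ k (frestrictLe k x) ∂trajMeasure μ₀ κ := by
  rw [← lintegral_map hg (g := fun x : Π k, X k => (frestrictLe k x, x (k + 1))) (by fun_prop),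
    ← map_frestrictLe_trajMeasure_compProd_eq_map_trajMeasure, Measure.lintegral_compProd hg,
    lintegral_map hg.lintegral_kernel_prod_right' (by fun_prop)]

end trajMeasure

variable {d n : ℕ} [NeZero n]

lemma totalRate_eq (hd : 1 ≤ d) (lam : ℝ≥0) (η : Config d n) :
    totalRate lam η = (1 + lam) * ∑ x, ((η x).numActive : ℝ≥0) := by
  have hd' : (d : ℝ≥0) ≠ 0 := by exact_mod_cast (by omega : d ≠ 0)
  have hclock : ∑ r : Ring d, clockRate lam r = 1 + lam := by
    rw [Fintype.sum_option]
    simp only [clockRate, Finset.sum_const, Finset.card_univ, Fintype.card_prod, Fintype.card_fin,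
      Fintype.card_units_int, nsmul_eq_mul]
    push_cast
    field_simp
    ring
  unfold totalRate rate
  rw [Fintype.sum_prod_type]
  simp only [← Finset.mul_sum, hclock, ← Finset.sum_mul]
  ring

lemma stable_iff_totalRate_eq_zero (hd : 1 ≤ d) (lam : ℝ≥0) (η : Config d n) :
    totalRate lam η = 0 ↔ Stable η := by
  rw [totalRate_eq hd, mul_eq_zero, or_iff_right (by positivity), Finset.sum_eq_zero_iff]
  simp [Stable]

lemma sum_clockRate_mul (lam : ℝ≥0) (F : Ring d → ℝ) :
    ∑ r, (clockRate lam r : ℝ) * F r = (1 + lam) * ringMean lam F := by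
  have : (1 + lam : ℝ) ≠ 0 := by positivity
  rw [Fintype.sum_option, ringMean, mul_div_cancel₀ _ this]
  simp only [clockRate]
  push_cast
  congr 1
  exact Finset.sum_congr rfl fun e _ => by ring

/-- The transition operator of the embedded jump chain. -/
noncomputable def stepOp (lam : ℝ≥0) (f : Config d n → ℝ≥0∞) (η : Config d n) : ℝ≥0∞ :=
  ∫⁻ ζ, f ζ ∂stepLaw lam η

lemma stepOp_of_stable (hd : 1 ≤ d) (lam : ℝ≥0) (f : Config d n → ℝ≥0∞) {η : Config d n}
    (h : Stable η) : stepOp lam f η = f η := by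
  rw [stepOp, stepLaw, if_pos ((stable_iff_totalRate_eq_zero hd lam η).2 h), lintegral_dirac]

lemma stepOp_of_not_stable (hd : 1 ≤ d) (lam : ℝ≥0) (f : Config d n → ℝ≥0∞) {η : Config d n}
    (h : ¬ Stable η) :
    stepOp lam f η = ∑ e, ((rate lam η e / totalRate lam η : ℝ≥0) : ℝ≥0∞) * f (apply η e) := by
  rw [stepOp, stepLaw, if_neg (mt (stable_iff_totalRate_eq_zero hd lam η).1 h),
    lintegral_finsetSum_measure]
  refine Finset.sum_congr rfl fun e _ => ?_
  rw [lintegral_smul_measure, lintegral_dirac]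
  rfl

lemma stepOp_mono (lam : ℝ≥0) {f g : Config d n → ℝ≥0∞} (h : f ≤ g) :
    stepOp lam f ≤ stepOp lam g :=
  fun _ => lintegral_mono h

lemma iterate_stepOp_mono (lam : ℝ≥0) (k : ℕ) {f g : Config d n → ℝ≥0∞} (h : f ≤ g) :
    (stepOp lam)^[k] f ≤ (stepOp lam)^[k] g :=
  Monotone.iterate (fun _ _ => stepOp_mono lam) k h

lemma iterate_stepOp_sum (lam : ℝ≥0) (k : ℕ) {ι : Type*} (s : Finset ι)
    (f : ι → Config d n → ℝ≥0∞) (η : Config d n) :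
    (stepOp lam)^[k] (fun ζ => ∑ i ∈ s, f i ζ) η = ∑ i ∈ s, (stepOp lam)^[k] (f i) η := by
  induction k generalizing η with
  | zero => rfl
  | succ k ih =>
    simp only [Function.iterate_succ_apply']
    rw [stepOp, funext ih, lintegral_finsetSum _ fun i _ => Measurable.of_discrete]
    rfl

lemma iterate_stepOp_of_stable (hd : 1 ≤ d) (lam : ℝ≥0) (f : Config d n → ℝ≥0∞) {η : Config d n}
    (h : Stable η) (k : ℕ) : (stepOp lam)^[k] f η = f η := by
  induction k with
  | zero => rfl
  | succ k ih => rw [Function.iterate_succ_apply', stepOp_of_stable hd lam _ h, ih]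

omit [NeZero n] in
lemma rate_eq_zero_of_not_active (lam : ℝ≥0) {η : Config d n} {e : Torus d n × Ring d}
    (h : ¬ 0 < (η e.1).numActive) : rate lam η e = 0 := by
  simp [rate, Nat.eq_zero_of_not_pos h]

/-- The number of particles is conserved. -/
lemma iterate_stepOp_total_ne (hd : 1 ≤ d) (lam : ℝ≥0) (k : ℕ) (η : Config d n) :
    (stepOp lam)^[k] ({ζ | total ζ ≠ total η}.indicator 1) η = 0 := by
  suffices ∀ N, ∀ η : Config d n, total η = N →
      (stepOp lam)^[k] ({ζ | total ζ ≠ N}.indicator 1) η = 0 from this _ η rfl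
  intro N
  induction k with
  | zero => intro η hη; simp [hη]
  | succ k ih =>
    intro η hη
    rw [Function.iterate_succ_apply']
    by_cases hst : Stable η
    · rw [stepOp_of_stable hd lam _ hst, ih η hη]
    · rw [stepOp_of_not_stable hd lam _ hst]
      refine Finset.sum_eq_zero fun e _ => ?_
      by_cases he : 0 < (η e.1).numActive
      · rw [ih _ ((total_apply he e.2).trans hη), mul_zero]
      · simp [rate_eq_zero_of_not_active lam he]

lemma ringMean_nonneg {lam : ℝ} (hlam : 0 ≤ lam) {F : Ring d → ℝ} (h : ∀ r, 0 ≤ F r) :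
    0 ≤ ringMean lam F :=
  div_nonneg (add_nonneg (mul_nonneg hlam (h _))
    (Finset.sum_nonneg fun e _ => div_nonneg (h _) (by positivity))) (by positivity)

omit [NeZero n] in
lemma settle_nonneg {lam : ℝ} (hlam : 0 ≤ lam) (A : Finset (Torus d n)) (k : ℕ)
    (η : Config d n) : 0 ≤ settle lam A k η := by
  induction k generalizing η with
  | zero => unfold settle; split_ifs <;> norm_num
  | succ k ih =>
    unfold settle
    split_ifs
    exacts [ringMean_nonneg hlam fun r => ih _, zero_le_one, le_rfl]

/-- The probability that the chain is in the state `asleepOn A` after `k` rings is at most the same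
probability when particles may only sleep on `A`. -/
lemma iterate_stepOp_asleepOn_le (hd : 1 ≤ d) (lam : ℝ≥0) (A : Finset (Torus d n)) (k : ℕ)
    (η : Config d n) :
    (stepOp lam)^[k] (({asleepOn A} : Set (Config d n)).indicator 1) η ≤
      ENNReal.ofReal (settle lam A k (wakeOff A η)) := by
  have hA : wakeOff A (asleepOn A) = asleepOn A := wakeOff_eq_of_forall fun x hx => by
    by_contra h
    simp [asleepOn, h] at hx
  have hstab : Stable (asleepOn A) := numActive_asleepOn A
  have hset : ∀ k, settle lam A k (asleepOn A) = 1 := fun k => by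
    rw [settle_of_stable _ _ hstab, settle, if_pos rfl]
  have hstable : ∀ k, ∀ η : Config d n, Stable η →
      (stepOp lam)^[k] (({asleepOn A} : Set (Config d n)).indicator 1) η ≤
        ENNReal.ofReal (settle lam A k (wakeOff A η)) := by
    intro k η hst
    rw [iterate_stepOp_of_stable hd lam _ hst]
    -- A stable `η` may become active under `wakeOff A`, but then it is not the target and the left
    -- side vanishes.
    by_cases hη : η = asleepOn A
    · subst hη
      simp [hA, hset]
    · simp [hη]
  induction k generalizing η with
  | zero =>
    by_cases hη : η = asleepOn A
    · subst hη
      simp [hA, hset]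
    · simp [hη]
  | succ k ih =>
    by_cases hst : Stable η
    · exact hstable _ _ hst
    rw [Function.iterate_succ_apply', stepOp_of_not_stable hd lam _ hst]
    have htot : (0 : ℝ) < totalRate lam η := NNReal.coe_pos.2
      (pos_iff_ne_zero.2 (mt (stable_iff_totalRate_eq_zero hd lam η).1 hst))
    calc ∑ e, ((rate lam η e / totalRate lam η : ℝ≥0) : ℝ≥0∞) *
          (stepOp lam)^[k] (({asleepOn A} : Set (Config d n)).indicator 1) (apply η e)
        ≤ ∑ e, ENNReal.ofReal ((rate lam η e : ℝ) / totalRate lam η *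
            settle lam A k (wakeOff A (apply η e))) := by
          refine Finset.sum_le_sum fun e _ => ?_
          rw [ENNReal.ofReal_mul (by positivity), ← NNReal.coe_div, ENNReal.ofReal_coe_nnreal]
          gcongr
          exact ih _
      _ = ENNReal.ofReal (∑ e, (rate lam η e : ℝ) / totalRate lam η *
            settle lam A k (wakeOff A (apply η e))) :=
          (ENNReal.ofReal_sum_of_nonneg fun e _ =>
            mul_nonneg (by positivity) (settle_nonneg lam.2 _ _ _)).symm
      _ = ENNReal.ofReal (settle lam A (k + 1) (wakeOff A η)) := by
          congr 1
          -- The chain picks its active site at random. By `settle_succ` each active site gives the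
          -- same value, so the average over sites is that value.
          have hx : ∀ x, ∑ r, (rate lam η (x, r) : ℝ) * settle lam A k (wakeOff A (apply η (x, r))) =
              (η x).numActive * (1 + lam) * settle lam A (k + 1) (wakeOff A η) := by
            intro x
            by_cases hact : 0 < (η x).numActive
            · rw [settle_succ lam A k (numActive_wakeOff_pos A hact), mul_assoc,
                ← sum_clockRate_mul, Finset.mul_sum]
              refine Finset.sum_congr rfl fun r _ => ?_
              rw [toppleOn_wakeOff A hact, rate]
              push_cast
              ring
            · simp [rate, Nat.eq_zero_of_not_pos hact]
          simp only [div_mul_eq_mul_div, ← Finset.sum_div]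
          rw [Fintype.sum_prod_type, div_eq_iff htot.ne', Finset.sum_congr rfl fun x _ => hx x,
            totalRate_eq hd]
          push_cast
          rw [← Finset.sum_mul, ← Finset.sum_mul]
          ring

lemma Stable.exists_eq_asleepOn {η : Config d n} (h : Stable η) :
    ∃ A : Finset (Torus d n), A.card = total η ∧ η = asleepOn A := by
  classical
  refine ⟨Finset.univ.filter fun x => η x = sleeping, ?_, funext fun x => ?_⟩
  · rw [Finset.card_filter]
    refine Finset.sum_congr rfl fun x _ => ?_
    have := h x
    rcases hx : η x with k | _
    · simp_all [numActive, count]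
    · simp [count]
  · have := h x
    rcases hx : η x with k | _
    · simp_all [numActive, asleepOn]
    · simp [asleepOn, hx]

lemma Stable.total_le {η : Config d n} (h : Stable η) : total η ≤ n ^ d := by
  obtain ⟨A, hA, -⟩ := h.exists_eq_asleepOn
  rw [← hA]
  exact (Finset.card_le_univ A).trans_eq (by simp [ZMod.card])

/-- The probability that the chain is stable after `k` rings, when it starts from `N` active
particles. -/
theorem iterate_stepOp_stable_le (hd : 1 ≤ d) {lam : ℝ≥0} (hlam : 0 < lam) (k : ℕ)
    {η : Config d n} (hη : ∀ x, η x ≠ sleeping) (hpos : 0 < total η) :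
    (stepOp lam)^[k] ({ζ | Stable ζ ∧ total ζ = total η}.indicator 1) η ≤
      ENNReal.ofReal ((n ^ d).choose (total η) *
        (k * ((2 * d) ^ n ^ d * (lam : ℝ) ^ (total η - 1)))) := by
  obtain ⟨pos, hpath⟩ := exists_isPath d n
  set s := Finset.univ.powersetCard (total η) (α := Torus d n) with hs
  have hle : ({ζ | Stable ζ ∧ total ζ = total η}.indicator 1 : Config d n → ℝ≥0∞) ≤
      fun ζ => ∑ A ∈ s, ({asleepOn A} : Set (Config d n)).indicator 1 ζ := by
    refine fun ζ => Set.indicator_apply_le' (fun hζ => ?_) fun _ => zero_le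
    obtain ⟨A, hA, hζA⟩ := hζ.1.exists_eq_asleepOn
    have hmem : A ∈ s := Finset.mem_powersetCard.2 ⟨Finset.subset_univ A, hA.trans hζ.2⟩
    refine le_trans ?_ (Finset.single_le_sum (fun _ _ => zero_le) hmem)
    simp [hζA]
  refine (iterate_stepOp_mono lam k hle η).trans ?_
  rw [iterate_stepOp_sum]
  have hcard : s.card = (n ^ d).choose (total η) := by
    rw [hs, Finset.card_powersetCard, Finset.card_univ]; simp [ZMod.card]
  have hbound : ∀ A ∈ s, (stepOp lam)^[k] (({asleepOn A} : Set (Config d n)).indicator 1) η ≤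
      ENNReal.ofReal (k * ((2 * d) ^ n ^ d * (lam : ℝ) ^ (total η - 1))) := by
    intro A hA
    have hcA : A.card = total η := (Finset.mem_powersetCard.1 hA).2
    refine (iterate_stepOp_asleepOn_le hd lam A k η).trans (ENNReal.ofReal_le_ofReal ?_)
    rw [wakeOff_eq_of_forall fun x hx => absurd hx (hη x), ← hcA]
    exact settle_le hd hlam hpath (Finset.card_pos.1 (by omega)) k hcA.symm hη
  refine (Finset.sum_le_card_nsmul _ _ _ hbound).trans_eq ?_
  rw [hcard, nsmul_eq_mul, ENNReal.ofReal_mul (Nat.cast_nonneg ((n ^ d).choose _)),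
    ENNReal.ofReal_natCast]

instance (μ : ℝ≥0) : IsProbabilityMeasure (initialLaw d n μ) :=
  Measure.isProbabilityMeasure_map Measurable.of_discrete.aemeasurable

instance (μ lam : ℝ≥0) : IsProbabilityMeasure (chainLaw d n μ lam) := by
  unfold chainLaw
  infer_instance

lemma map_zero_chainLaw (μ lam : ℝ≥0) :
    (chainLaw d n μ lam).map (fun x => x 0) = initialLaw d n μ :=
  map_zero_trajMeasure _ _

lemma lintegral_chainLaw_succ (μ lam : ℝ≥0) (k : ℕ) (g : Config d n → Config d n → ℝ≥0∞) :
    ∫⁻ x, g (x 0) (x (k + 1)) ∂chainLaw d n μ lam =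
      ∫⁻ x, stepOp lam (g (x 0)) (x k) ∂chainLaw d n μ lam := by
  have hg : Measurable fun p : Config d n × Config d n => g p.1 p.2 := Measurable.of_discrete
  have hev : Measurable fun p : ((i : Finset.Iic k) → Config d n) × Config d n =>
      (p.1 ⟨0, Finset.mem_Iic.2 (Nat.zero_le k)⟩, p.2) := by fun_prop
  exact lintegral_trajMeasure_succ (X := fun _ => Config d n) (initialLaw d n μ)
    (fun k => (stepKernel d n lam).comap
      (fun h : (i : Finset.Iic k) → Config d n => h ⟨k, Finset.mem_Iic.2 le_rfl⟩)
      (measurable_pi_apply _)) k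
    (fun p => g (p.1 ⟨0, Finset.mem_Iic.2 (Nat.zero_le k)⟩) p.2)
    (hg.comp hev)

lemma lintegral_chainLaw (μ lam : ℝ≥0) (k : ℕ) (g : Config d n → Config d n → ℝ≥0∞) :
    ∫⁻ x, g (x 0) (x k) ∂chainLaw d n μ lam =
      ∫⁻ η, (stepOp lam)^[k] (g η) η ∂initialLaw d n μ := by
  induction k generalizing g with
  | zero =>
    rw [← map_zero_chainLaw μ lam,
      lintegral_map Measurable.of_discrete (measurable_pi_apply 0)]
    rfl
  | succ k ih =>
    rw [lintegral_chainLaw_succ, ih fun η => stepOp lam (g η)]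
    rfl

end ARW

/-! ### Laplace transforms, tail estimates, and the law of the chain. -/

namespace ARW

open SiteState

lemma measure_le_lintegral_of_one_le {Ω : Type*} [MeasurableSpace Ω] (P : Measure Ω) {s : Set Ω}
    (hs : MeasurableSet s) {f : Ω → ℝ≥0∞} (h : ∀ ω ∈ s, 1 ≤ f ω) : P s ≤ ∫⁻ ω, f ω ∂P := by
  rw [← lintegral_indicator_one hs]
  exact lintegral_mono fun ω => Set.indicator_apply_le' (fun hω => h ω hω) fun _ => zero_le

lemma lintegral_exp_neg_poissonMeasure (r : ℝ≥0) (θ : ℝ) :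
    ∫⁻ k : ℕ, ENNReal.ofReal (Real.exp (-(θ * k))) ∂poissonMeasure r =
      ENNReal.ofReal (Real.exp (r * (Real.exp (-θ) - 1))) := by
  have h : HasSum (fun k : ℕ => Real.exp (-r) * r ^ k / k.factorial * Real.exp (-(θ * k)))
      (Real.exp (r * (Real.exp (-θ) - 1))) := by
    convert! (NormedSpace.expSeries_div_hasSum_exp (r * Real.exp (-θ) : ℝ)).mul_left
      (Real.exp (-r)) using 1
    · funext k
      rw [mul_pow, ← Real.exp_nat_mul, show (k : ℝ) * -θ = -(θ * k) by ring]
      ring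
    · rw [← Real.exp_eq_exp_ℝ, ← Real.exp_add]
      congr 1
      ring
  rw [poissonMeasure, lintegral_sum_measure]
  simp only [lintegral_smul_measure, lintegral_dirac, smul_eq_mul]
  rw [← h.tsum_eq, ENNReal.ofReal_tsum_of_nonneg (fun k => by positivity) h.summable]
  refine tsum_congr fun k => ?_
  rw [ENNReal.ofReal_mul (by positivity)]

/-- Tilting by `exp (-x)` turns the density of rate `1` into half the density of rate `2`. -/
lemma lintegral_exp_neg_expMeasure :
    ∫⁻ x, ENNReal.ofReal (Real.exp (-x)) ∂expMeasure 1 = ENNReal.ofReal (1 / 2) := by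
  have hpdf : ∀ x, exponentialPDF 1 x * ENNReal.ofReal (Real.exp (-x)) =
      ENNReal.ofReal (1 / 2) * exponentialPDF 2 x := by
    intro x
    rcases lt_or_ge x 0 with hx | hx
    · simp [exponentialPDF_of_neg hx]
    · rw [exponentialPDF_of_nonneg hx, exponentialPDF_of_nonneg hx,
        ← ENNReal.ofReal_mul (by positivity), ← ENNReal.ofReal_mul (by positivity)]
      congr 1
      rw [show -(2 * x) = -(1 * x) + -x by ring, Real.exp_add]
      ring
  have hm : ∀ r : ℝ, Measurable (exponentialPDF r) := fun r =>
    (measurable_exponentialPDFReal r).ennreal_ofReal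
  have hexp : expMeasure 1 = volume.withDensity (exponentialPDF 1) := rfl
  rw [hexp, lintegral_withDensity_eq_lintegral_mul _ (hm 1) (by fun_prop)]
  simp only [Pi.mul_apply, hpdf]
  rw [lintegral_const_mul _ (hm 2), lintegral_exponentialPDF_eq_one two_pos, mul_one]

instance : IsProbabilityMeasure (expMeasure 1) := isProbabilityMeasure_expMeasure one_pos

/-- Lower tail of a sum of independent exponential variables. -/
lemma sum_exponential_le (K : ℕ) (M : ℝ) :
    (Measure.infinitePi fun _ : ℕ => expMeasure 1)
        {w | ∑ j ∈ Finset.range K, ENNReal.ofReal (w j) ≤ ENNReal.ofReal M} ≤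
      ENNReal.ofReal (Real.exp (max M 0) * (1 / 2) ^ K) := by
  have hmeas : MeasurableSet {w : ℕ → ℝ |
      ∑ j ∈ Finset.range K, ENNReal.ofReal (w j) ≤ ENNReal.ofReal M} :=
    measurableSet_le (by fun_prop) measurable_const
  refine (measure_le_lintegral_of_one_le _ hmeas
    (f := fun w => ENNReal.ofReal (Real.exp (max M 0)) *
      ∏ j ∈ Finset.range K, ENNReal.ofReal (Real.exp (-(w j)))) fun w hw => ?_).trans_eq ?_
  · rw [← ENNReal.ofReal_prod_of_nonneg fun _ _ => (Real.exp_pos _).le, ← Real.exp_sum,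
      ← ENNReal.ofReal_mul (Real.exp_pos _).le, ← Real.exp_add, ENNReal.one_le_ofReal,
      Real.one_le_exp_iff, Finset.sum_neg_distrib]
    have h : ∑ j ∈ Finset.range K, ENNReal.ofReal (w j) ≤ ENNReal.ofReal (max M 0) :=
      le_trans hw (ENNReal.ofReal_le_ofReal (le_max_left _ _))
    -- `ENNReal.ofReal` truncates at `0`, so the inequality concerns positive parts, which dominate
    -- the `w j`.
    have h' : ENNReal.ofReal (∑ j ∈ Finset.range K, max (w j) 0) ≤ ENNReal.ofReal (max M 0) := by
      rw [ENNReal.ofReal_sum_of_nonneg fun _ _ => le_max_right _ _]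
      refine (Finset.sum_congr rfl fun j _ => ?_).trans_le h
      rcases le_total 0 (w j) with hj | hj
      · rw [max_eq_left hj]
      · rw [max_eq_right hj, ENNReal.ofReal_of_nonpos hj, ENNReal.ofReal_zero]
    have h'' := (ENNReal.ofReal_le_ofReal_iff (le_max_right M 0)).1 h'
    have : ∑ j ∈ Finset.range K, w j ≤ ∑ j ∈ Finset.range K, max (w j) 0 :=
      Finset.sum_le_sum fun _ _ => le_max_left _ _
    linarith
  · rw [lintegral_const_mul _ (by fun_prop), lintegral_prod_eq_prod_lintegral_of_indepFun _
      (fun j (w : ℕ → ℝ) => ENNReal.ofReal (Real.exp (-(w j))))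
      (iIndepFun_infinitePi (X := fun _ x => ENNReal.ofReal (Real.exp (-x))) fun _ => by fun_prop)
      (fun j => by fun_prop)]
    have hj : ∀ j : ℕ, ∫⁻ w, ENNReal.ofReal (Real.exp (-(w j)))
        ∂(Measure.infinitePi fun _ : ℕ => expMeasure 1) = ENNReal.ofReal (1 / 2) := by
      intro j
      rw [← lintegral_exp_neg_expMeasure]
      exact (measurePreserving_eval_infinitePi (fun _ : ℕ => expMeasure 1) j).lintegral_comp
        (f := fun x => ENNReal.ofReal (Real.exp (-x))) (by fun_prop)
    rw [Finset.prod_congr rfl fun j _ => hj j, Finset.prod_const, Finset.card_range,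
      ENNReal.ofReal_mul (Real.exp_pos _).le, ENNReal.ofReal_pow (by norm_num)]

variable {d n : ℕ} [NeZero n]

lemma total_active (k : Torus d n → ℕ) :
    total (fun x => active (k x)) = ∑ x, k x := rfl

lemma initialLaw_apply (μ : ℝ≥0) (s : Set (Config d n)) :
    initialLaw d n μ s = (Measure.pi fun _ : Torus d n => poissonMeasure μ)
      {k | (fun x => active (k x)) ∈ s} := by
  rw [initialLaw, Measure.map_apply Measurable.of_discrete .of_discrete]
  rfl

/-- Lower tail of the initial number of particles. -/
lemma initialLaw_total_lt_le (μ : ℝ≥0) {θ : ℝ} (hθ : 0 ≤ θ) (m : ℝ) :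
    initialLaw d n μ {η | (total η : ℝ) < m} ≤
      ENNReal.ofReal (Real.exp (θ * m + (n : ℝ) ^ d * (μ * (Real.exp (-θ) - 1)))) := by
  rw [initialLaw_apply]
  refine (measure_le_lintegral_of_one_le _ .of_discrete
    (f := fun k => ENNReal.ofReal (Real.exp (θ * m)) *
      ∏ x : Torus d n, ENNReal.ofReal (Real.exp (-(θ * k x)))) fun k hk => ?_).trans_eq ?_
  · rw [← ENNReal.ofReal_prod_of_nonneg fun _ _ => (Real.exp_pos _).le, ← Real.exp_sum,
      ← ENNReal.ofReal_mul (Real.exp_pos _).le, ← Real.exp_add, ENNReal.one_le_ofReal,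
      Real.one_le_exp_iff, Finset.sum_neg_distrib, ← Finset.mul_sum]
    have hk' : ((∑ x, k x : ℕ) : ℝ) < m := hk
    push_cast at hk'
    linarith [mul_le_mul_of_nonneg_left hk'.le hθ]
  · rw [lintegral_const_mul _ Measurable.of_discrete, lintegral_prod_eq_prod_lintegral_of_indepFun _
      (fun x (k : Torus d n → ℕ) => ENNReal.ofReal (Real.exp (-(θ * k x))))
      (iIndepFun_pi (X := fun _ (k : ℕ) => ENNReal.ofReal (Real.exp (-(θ * k))))
        fun _ => Measurable.of_discrete.aemeasurable)
      (fun _ => Measurable.of_discrete)]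
    have hx : ∀ x : Torus d n, ∫⁻ k, ENNReal.ofReal (Real.exp (-(θ * (k x : ℕ))))
        ∂(Measure.pi fun _ : Torus d n => poissonMeasure μ) =
          ENNReal.ofReal (Real.exp (μ * (Real.exp (-θ) - 1))) := by
      intro x
      rw [← lintegral_exp_neg_poissonMeasure]
      exact (measurePreserving_eval (fun _ : Torus d n => poissonMeasure μ) x).lintegral_comp
        (f := fun k : ℕ => ENNReal.ofReal (Real.exp (-(θ * k)))) Measurable.of_discrete
    rw [Finset.prod_congr rfl fun x _ => hx x, Finset.prod_const, Finset.card_univ,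
      ← ENNReal.ofReal_pow (Real.exp_pos _).le, ← Real.exp_nat_mul,
      ← ENNReal.ofReal_mul (Real.exp_pos _).le, ← Real.exp_add]
    simp [ZMod.card]

/-- With positive probability there are more particles than sites. -/
lemma initialLaw_total_le_lt_one {μ : ℝ≥0} (hμ : 0 < μ) :
    initialLaw d n μ {η | total η ≤ n ^ d} < 1 := by
  have hpos : 0 < initialLaw d n μ {η | total η ≤ n ^ d}ᶜ := by
    rw [initialLaw_apply]
    have hsub : ({fun _ => n ^ d + 1} : Set (Torus d n → ℕ)) ⊆
        {k | (fun x => active (k x)) ∈ {η : Config d n | total η ≤ n ^ d}ᶜ} := by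
      rintro k rfl
      simp only [Set.mem_ofPred_eq, Set.mem_compl_iff, total_active, not_le]
      exact (Nat.lt_succ_self _).trans_le
        (Finset.single_le_sum (f := fun _ : Torus d n => n ^ d + 1) (fun _ _ => Nat.zero_le _)
          (Finset.mem_univ 0))
    refine lt_of_lt_of_le ?_ (measure_mono hsub)
    rw [Measure.pi_singleton]
    refine pos_iff_ne_zero.2 (Finset.prod_ne_zero_iff.2 fun x _ => ?_)
    rw [poissonMeasure_singleton]
    exact (ENNReal.ofReal_pos.2 (by positivity)).ne'
  have := prob_compl_eq_one_sub (μ := initialLaw d n μ)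
    (s := {η | total η ≤ n ^ d}) .of_discrete
  rw [this] at hpos
  exact tsub_pos_iff_lt.1 hpos

lemma chainLaw_apply (μ lam : ℝ≥0) (k : ℕ) (p : Config d n → Config d n → Prop) :
    chainLaw d n μ lam {x | p (x 0) (x k)} =
      ∫⁻ η, (stepOp lam)^[k] ({ζ | p η ζ}.indicator 1) η ∂initialLaw d n μ := by
  have hm : Measurable fun x : ℕ → Config d n => (x 0, x k) := by fun_prop
  have hs : MeasurableSet {x : ℕ → Config d n | p (x 0) (x k)} :=
    hm (.of_discrete (s := {q : Config d n × Config d n | p q.1 q.2}))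
  rw [← lintegral_indicator_one hs, ← lintegral_chainLaw μ lam k fun η => {ζ | p η ζ}.indicator 1]
  rfl

lemma chainLaw_total_ne (hd : 1 ≤ d) (μ lam : ℝ≥0) :
    chainLaw d n μ lam {x | ∃ k, total (x k) ≠ total (x 0)} = 0 := by
  rw [show {x : ℕ → Config d n | ∃ k, total (x k) ≠ total (x 0)} =
    ⋃ k, {x | total (x k) ≠ total (x 0)} by ext; simp]
  refine measure_iUnion_null fun k => ?_
  rw [chainLaw_apply μ lam k fun η ζ => total ζ ≠ total η]
  simp [iterate_stepOp_total_ne hd]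

lemma chainLaw_stable_le (hd : 1 ≤ d) (μ : ℝ≥0) {lam : ℝ≥0} (hlam : 0 < lam) (k : ℕ) {m B : ℝ}
    (hm : 0 < m) (hB : ∀ N : ℕ, m ≤ N → (n ^ d).choose N *
      (k * ((2 * d) ^ n ^ d * (lam : ℝ) ^ (N - 1))) ≤ B) :
    chainLaw d n μ lam {x | Stable (x k) ∧ total (x k) = total (x 0) ∧ m ≤ total (x 0)} ≤
      ENNReal.ofReal B := by
  rw [chainLaw_apply μ lam k fun η ζ => Stable ζ ∧ total ζ = total η ∧ m ≤ total η, initialLaw,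
    lintegral_map Measurable.of_discrete Measurable.of_discrete]
  refine (lintegral_mono fun N => ?_).trans_eq (lintegral_const (ENNReal.ofReal B)) |>.trans_eq
    (by rw [measure_univ, mul_one])
  set η : Config d n := fun x => active (N x)
  by_cases hη : m ≤ total η
  · have hpos : 0 < total η := by exact_mod_cast hm.trans_le hη
    simp only [hη, and_true]
    exact (iterate_stepOp_stable_le hd hlam k (fun x => by simp [η]) hpos).trans
      (ENNReal.ofReal_le_ofReal (hB _ hη))
  -- The left set is empty here; the inclusion lets conservation of particles supply the value `0`.
  · have h₁ : {ζ : Config d n | Stable ζ ∧ total ζ = total η ∧ m ≤ total η} ⊆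
        {ζ | total ζ ≠ total η} := fun ζ hζ => absurd hζ.2.2 hη
    refine le_of_le_of_eq (iterate_stepOp_mono lam k
      (Set.indicator_le_indicator_of_subset h₁ (fun _ => zero_le)) η) ?_ |>.trans zero_le
    exact iterate_stepOp_total_ne hd lam k η

end ARW

/-! ### From rings to continuous time, and the entropy estimate. -/

namespace ARW

lemma exists_of_fixationTime_lt {d n : ℕ} [NeZero n] {lam : ℝ≥0}
    {ω : (ℕ → Config d n) × (ℕ → ℝ)} {t : ℝ≥0∞} (h : fixationTime lam ω < t) :
    ∃ k, ringTime lam ω k < t ∧ Stable (ω.1 k) := by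
  obtain ⟨s, ⟨η, ⟨k, hk, -, rfl⟩, hη⟩, hs⟩ := sInf_lt_iff.1 h
  exact ⟨k, hk.trans_lt hs, hη⟩

variable {d n : ℕ} [NeZero n]

lemma totalRate_le (hd : 1 ≤ d) (lam : ℝ≥0) (η : Config d n) :
    totalRate lam η ≤ (1 + lam) * total η := by
  rw [totalRate_eq hd, total, Nat.cast_sum]
  gcongr with x
  cases η x <;> simp [SiteState.numActive, SiteState.count]

lemma arwLaw_preimage_fst (μ lam : ℝ≥0) (s : Set (ℕ → Config d n)) :
    arwLaw d n μ lam {ω | ω.1 ∈ s} = chainLaw d n μ lam s := by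
  rw [arwLaw, show {ω : (ℕ → Config d n) × (ℕ → ℝ) | ω.1 ∈ s} = s ×ˢ Set.univ by ext; simp,
    Measure.prod_prod, measure_univ, mul_one]

lemma arwLaw_preimage_snd (μ lam : ℝ≥0) (s : Set (ℕ → ℝ)) :
    arwLaw d n μ lam {ω | ω.2 ∈ s} = (Measure.infinitePi fun _ : ℕ => expMeasure 1) s := by
  rw [arwLaw, show {ω : (ℕ → Config d n) × (ℕ → ℝ) | ω.2 ∈ s} = Set.univ ×ˢ s by ext; simp,
    Measure.prod_prod, measure_univ, one_mul]

lemma arwLaw_initial (μ lam : ℝ≥0) (s : Set (Config d n)) :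
    arwLaw d n μ lam {ω | ω.1 0 ∈ s} = initialLaw d n μ s := by
  rw [← map_zero_chainLaw μ lam, Measure.map_apply (measurable_pi_apply 0) .of_discrete,
    ← arwLaw_preimage_fst μ lam]
  rfl

lemma arwLaw_total_ne (hd : 1 ≤ d) (μ lam : ℝ≥0) :
    arwLaw d n μ lam {ω | ∃ k, total (ω.1 k) ≠ total (ω.1 0)} = 0 :=
  (arwLaw_preimage_fst μ lam _).trans (chainLaw_total_ne hd μ lam)

/-- Early fixation forces one of three events: few initial particles, stability after some `k ≤ K`
rings, or `K` rings before time `τ`. In the last case the total number of particles is at most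
`n^d`, which bounds the rates and reduces the event to a small sum of exponential variables. -/
theorem arwLaw_fixationTime_lt_le (hd : 1 ≤ d) (μ : ℝ≥0) {lam : ℝ≥0} (hlam : 0 < lam)
    {m B τ : ℝ} (hm : 0 < m) (hτ : 0 ≤ τ) (K : ℕ)
    (hB : ∀ k ≤ K, ∀ N : ℕ, m ≤ N → (n ^ d).choose N *
      (k * ((2 * d) ^ n ^ d * (lam : ℝ) ^ (N - 1))) ≤ B) :
    arwLaw d n μ lam {ω | fixationTime lam ω < ENNReal.ofReal τ} ≤
      initialLaw d n μ {η | (total η : ℝ) < m} + (K + 1) * ENNReal.ofReal B +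
        ENNReal.ofReal (Real.exp (τ * ((1 + lam) * n ^ d)) * (1 / 2) ^ K) := by
  have hM : 0 ≤ τ * ((1 + lam) * (n : ℝ) ^ d) := by positivity
  have hsub : {ω | fixationTime lam ω < ENNReal.ofReal τ} ⊆
      (({ω : (ℕ → Config d n) × (ℕ → ℝ) | ∃ k, total (ω.1 k) ≠ total (ω.1 0)} ∪
        {ω | ω.1 0 ∈ {η : Config d n | (total η : ℝ) < m}}) ∪
        ⋃ k ∈ Finset.range (K + 1), {ω | ω.1 ∈ {x : ℕ → Config d n |
          Stable (x k) ∧ total (x k) = total (x 0) ∧ m ≤ total (x 0)}}) ∪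
        {ω | ω.2 ∈ {w : ℕ → ℝ | ∑ j ∈ Finset.range K, ENNReal.ofReal (w j) ≤
          ENNReal.ofReal (τ * ((1 + lam) * n ^ d))}} := by
    intro ω hω
    obtain ⟨k, hkt, hst⟩ := exists_of_fixationTime_lt hω
    by_contra hnot
    simp only [Set.mem_union, not_or, Set.mem_iUnion, not_exists] at hnot
    obtain ⟨⟨⟨h₁, h₂⟩, h₃⟩, h₄⟩ := hnot
    have hcons : ∀ k, total (ω.1 k) = total (ω.1 0) := fun k => by
      by_contra h
      exact h₁ ⟨k, h⟩
    have hle : ∀ j, total (ω.1 j) ≤ n ^ d := fun j => by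
      rw [hcons j, ← hcons k]
      exact hst.total_le
    rcases Nat.lt_or_ge K k with hk | hk
    · refine h₄ ?_
      have hR : ∀ j, (totalRate lam (ω.1 j) : ℝ≥0∞) ≤
          ENNReal.ofReal ((1 + lam) * (n : ℝ) ^ d) := by
        intro j
        rw [← ENNReal.ofReal_coe_nnreal]
        refine ENNReal.ofReal_le_ofReal ?_
        have h := (totalRate_le hd lam (ω.1 j)).trans
          (mul_le_mul_right (Nat.cast_le.2 (hle j)) (1 + lam))
        exact_mod_cast h
      have hR0 : 0 < ENNReal.ofReal ((1 + lam) * (n : ℝ) ^ d) :=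
        ENNReal.ofReal_pos.2 (mul_pos (by positivity)
          (pow_pos (Nat.cast_pos.2 (NeZero.pos n)) _))
      have hsum : ∑ j ∈ Finset.range K, ENNReal.ofReal (ω.2 j) /
          ENNReal.ofReal ((1 + lam) * (n : ℝ) ^ d) ≤ ENNReal.ofReal τ := by
        refine le_trans ?_ hkt.le
        unfold ringTime
        refine (Finset.sum_le_sum fun j _ => ENNReal.div_le_div_left (hR j) _).trans
          (Finset.sum_le_sum_of_subset (Finset.range_mono hk.le))
      simp only [div_eq_mul_inv, ← Finset.sum_mul] at hsum
      rw [← div_eq_mul_inv, ENNReal.div_le_iff hR0.ne' ENNReal.ofReal_ne_top,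
        ← ENNReal.ofReal_mul hτ] at hsum
      exact hsum
    · exact h₃ k (Finset.mem_range.2 (Nat.lt_succ_of_le hk)) ⟨hst, hcons k, not_lt.1 h₂⟩
  have hunion : arwLaw d n μ lam (⋃ k ∈ Finset.range (K + 1), {ω | ω.1 ∈ {x : ℕ → Config d n |
      Stable (x k) ∧ total (x k) = total (x 0) ∧ m ≤ total (x 0)}}) ≤
        (K + 1) * ENNReal.ofReal B := by
    refine (measure_biUnion_finset_le _ _).trans
      ((Finset.sum_le_card_nsmul _ _ (ENNReal.ofReal B) fun k hk => ?_).trans_eq ?_)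
    · rw [arwLaw_preimage_fst]
      exact chainLaw_stable_le hd μ hlam k hm
        (hB k (Nat.lt_succ_iff.1 (Finset.mem_range.1 hk)))
    · rw [Finset.card_range, nsmul_eq_mul]
      push_cast
      rfl
  refine (measure_mono hsub).trans ((measure_union_le _ _).trans (add_le_add
    ((measure_union_le _ _).trans (add_le_add ((measure_union_le _ _).trans ?_) hunion)) ?_))
  · rw [arwLaw_total_ne hd, zero_add, arwLaw_initial]
  · rw [arwLaw_preimage_snd]
    have := sum_exponential_le K (τ * ((1 + lam) * (n : ℝ) ^ d))
    rwa [max_eq_left hM] at this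

lemma arwLaw_fixationTime_lt_le_initialLaw (hd : 1 ≤ d) (μ lam : ℝ≥0) (t : ℝ≥0∞) :
    arwLaw d n μ lam {ω | fixationTime lam ω < t} ≤
      initialLaw d n μ {η | total η ≤ n ^ d} := by
  have hsub : {ω | fixationTime lam ω < t} ⊆
      {ω : (ℕ → Config d n) × (ℕ → ℝ) | ∃ k, total (ω.1 k) ≠ total (ω.1 0)} ∪
        {ω | ω.1 0 ∈ {η : Config d n | total η ≤ n ^ d}} := by
    intro ω hω
    obtain ⟨k, -, hst⟩ := exists_of_fixationTime_lt hω
    by_cases h : total (ω.1 k) = total (ω.1 0)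
    · exact Or.inr (h.symm.trans_le hst.total_le)
    · exact Or.inl ⟨k, h⟩
  refine (measure_mono hsub).trans ((measure_union_le _ _).trans_eq ?_)
  rw [arwLaw_total_ne hd, zero_add, arwLaw_initial]

/-- One term of the binomial expansion of `(1 + θ * lam) ^ V` is at most the whole. With `1 ≤ θ` the
bound is uniform in all `N ≥ y`. -/
lemma choose_mul_pow_le {θ lam : ℝ} (hθ : 1 ≤ θ) (hlam : 0 ≤ lam) (V N : ℕ) {y : ℝ}
    (hy : y ≤ N) : V.choose N * lam ^ N ≤ θ ^ (-y) * (1 + θ * lam) ^ V := by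
  have hθ0 : 0 < θ := by linarith
  have h₁ : V.choose N * (θ * lam) ^ N ≤ (1 + θ * lam) ^ V := by
    rcases le_or_gt N V with h | h
    · rw [add_comm, add_pow]
      refine le_trans (le_of_eq ?_) (Finset.single_le_sum
        (f := fun i => (θ * lam) ^ i * 1 ^ (V - i) * (V.choose i : ℝ))
        (fun i _ => by positivity) (Finset.mem_range.2 (Nat.lt_succ_of_le h)))
      simp only [one_pow]
      ring
    · rw [Nat.choose_eq_zero_of_lt h, Nat.cast_zero, zero_mul]
      positivity
  have h₂ : θ ^ (-(N : ℝ)) ≤ θ ^ (-y) := Real.rpow_le_rpow_of_exponent_le hθ (by linarith)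
  calc V.choose N * lam ^ N = θ ^ (-(N : ℝ)) * (V.choose N * (θ * lam) ^ N) := by
        rw [Real.rpow_neg hθ0.le, Real.rpow_natCast, mul_pow]
        field_simp
    _ ≤ θ ^ (-y) * (1 + θ * lam) ^ V := by gcongr

lemma exists_entropy_bound (hd : 1 ≤ d) {μ lam : ℝ} (hμ : 0 < μ) (hμ' : μ < 1) (hlam : 0 < lam)
    (h : 2 * d * (2 * d * lam) ^ μ < μ ^ μ * (1 - μ) ^ (1 - μ)) :
    ∃ ε, 0 < ε ∧ ε < μ ∧ ∃ ρ, 0 < ρ ∧ ρ < 1 ∧ ∀ V N : ℕ, 0 < N → (μ - ε) * V ≤ N →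
      V.choose N * ((2 * d) ^ V * lam ^ (N - 1)) ≤ lam⁻¹ * ρ ^ V := by
  have hd' : (1 : ℝ) ≤ d := by exact_mod_cast hd
  set t : ℝ := 2 * d * lam with ht
  have ht0 : 0 < t := by positivity
  have hq : 0 < 1 - μ := by linarith
  -- This value minimizes `θ ^ (-μ) * (1 + θ * t)`, and the minimum produces the entropy term of the
  -- hypothesis.
  set θ : ℝ := μ / ((1 - μ) * t) with hθ
  have hθ0 : 0 < θ := by positivity
  have htμ : t < μ := by
    rw [← Real.rpow_lt_rpow_iff ht0.le hμ.le hμ]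
    have h₁ : (1 - μ) ^ (1 - μ) ≤ 1 := Real.rpow_le_one hq.le (by linarith) hq.le
    have h₂ : 0 < t ^ μ := Real.rpow_pos_of_pos ht0 μ
    have h₃ : 0 < μ ^ μ := Real.rpow_pos_of_pos hμ μ
    nlinarith
  have hθ1 : 1 ≤ θ := by
    rw [hθ, le_div_iff₀ (by positivity)]
    nlinarith
  have hθlam : 1 + θ * lam ≤ 1 / (1 - μ) := by
    have : θ * lam ≤ θ * t := by
      gcongr
      rw [ht]
      nlinarith
    have h' : θ * t = μ / (1 - μ) := by
      rw [hθ]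
      field_simp
    have h'' : 1 + μ / (1 - μ) = 1 / (1 - μ) := by
      field_simp
      ring
    linarith
  have hρ₀ : 2 * d * θ ^ (-μ) / (1 - μ) < 1 := by
    have h₁ : θ ^ (-μ) = (1 - μ) ^ μ * t ^ μ / μ ^ μ := by
      rw [Real.rpow_neg hθ0.le, hθ, Real.div_rpow hμ.le (by positivity),
        Real.mul_rpow hq.le ht0.le, inv_div]
    rw [Real.rpow_sub hq, Real.rpow_one] at h
    have h₂ : 0 < (1 - μ) ^ μ := Real.rpow_pos_of_pos hq μ
    have h₃ : 0 < μ ^ μ := Real.rpow_pos_of_pos hμ μ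
    rw [← mul_div_assoc, lt_div_iff₀ h₂] at h
    rw [div_lt_one hq, h₁, ← mul_div_assoc, div_lt_iff₀ h₃]
    linarith
  -- The strict inequality at density `μ` persists at density `μ - ε`, which leaves room for the
  -- fluctuations of the initial number of particles.
  have hcont : Filter.Tendsto (fun ε : ℝ => 2 * d * θ ^ (-(μ - ε)) / (1 - μ))
      (nhdsWithin 0 (Set.Ioi 0)) (nhds (2 * d * θ ^ (-μ) / (1 - μ))) := by
    have : Continuous fun ε : ℝ => 2 * d * θ ^ (-(μ - ε)) / (1 - μ) := by
      have := Real.continuous_const_rpow hθ0.ne'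
      fun_prop
    have := (this.tendsto 0).mono_left (nhdsWithin_le_nhds (s := Set.Ioi 0))
    simpa using this
  obtain ⟨ε, ⟨hερ, hεμ⟩, hε0⟩ := ((hcont.eventually (gt_mem_nhds hρ₀)).and
    (nhdsWithin_le_nhds (gt_mem_nhds hμ)) |>.and self_mem_nhdsWithin).exists
  refine ⟨ε, hε0, hεμ, _, ?_, hερ, fun V N hN hVN => ?_⟩
  · have := Real.rpow_pos_of_pos hθ0 (-(μ - ε))
    positivity
  have hpow : lam ^ (N - 1) = lam⁻¹ * lam ^ N := by
    obtain ⟨N, rfl⟩ := Nat.exists_eq_succ_of_ne_zero hN.ne'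
    rw [Nat.succ_sub_one, pow_succ]
    field_simp
  have hrpow : θ ^ (-((μ - ε) * V)) = (θ ^ (-(μ - ε))) ^ V := by
    rw [← Real.rpow_natCast, ← Real.rpow_mul hθ0.le]
    ring_nf
  calc V.choose N * ((2 * d) ^ V * lam ^ (N - 1))
      = lam⁻¹ * (2 * d) ^ V * (V.choose N * lam ^ N) := by rw [hpow]; ring
    _ ≤ lam⁻¹ * (2 * d) ^ V * (θ ^ (-((μ - ε) * V)) * (1 + θ * lam) ^ V) := by
        exact mul_le_mul_of_nonneg_left (choose_mul_pow_le hθ1 hlam.le V N hVN) (by positivity)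
    _ ≤ lam⁻¹ * (2 * d) ^ V * (θ ^ (-((μ - ε) * V)) * (1 / (1 - μ)) ^ V) := by
        gcongr
    _ = lam⁻¹ * (2 * d * θ ^ (-(μ - ε)) / (1 - μ)) ^ V := by
        rw [hrpow]
        simp only [mul_pow, div_pow, one_pow]
        ring

end ARW

/-! ### Choice of the exponents and conclusion. -/

namespace ARW

variable {d : ℕ}

lemma exists_poisson_rate {μ ε : ℝ} (hμ : 0 < μ) (hμ' : μ < 1) (hε : 0 < ε) :
    ∃ α, 0 < α ∧ ε * (μ - ε) + μ * (Real.exp (-ε) - 1) ≤ -α := by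
  -- Here `exp (-ε)` is replaced by its upper bound `1 / (1 + ε)`.
  refine ⟨-(ε * (μ - ε) + μ * (1 / (1 + ε) - 1)), ?_, ?_⟩
  · have : -(ε * (μ - ε) + μ * (1 / (1 + ε) - 1)) = ε ^ 2 * (1 + ε - μ) / (1 + ε) := by
      field_simp
      ring
    rw [this]
    have : 0 < 1 + ε - μ := by linarith
    positivity
  · rw [neg_neg, Real.exp_neg, ← one_div]
    have : 1 + ε ≤ Real.exp ε := by linarith [Real.add_one_le_exp ε]
    gcongr

lemma exp_mul_half_pow_le {M V : ℝ} {K : ℕ} (hK : 2 * (M + V) ≤ K) :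
    Real.exp M * (1 / 2) ^ K ≤ Real.exp (-V) := by
  have h : ((1 : ℝ) / 2) ^ K = Real.exp (-(K * Real.log 2)) := by
    rw [Real.exp_neg, Real.exp_nat_mul, Real.exp_log two_pos, one_div, inv_pow]
  rw [h, ← Real.exp_add, Real.exp_le_exp]
  nlinarith [Real.log_two_gt_d9, Nat.cast_nonneg (α := ℝ) K]

lemma sq_mul_exp_le {γ V : ℝ} (hγ : 0 < γ) (hV : 0 ≤ V) :
    V ^ 2 * Real.exp (-(3 / 4 * γ * V)) ≤ 32 / γ ^ 2 * Real.exp (-(γ / 2 * V)) := by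
  have h := Real.quadratic_le_exp_of_nonneg (x := γ / 4 * V) (by positivity)
  have h' : V ^ 2 ≤ 32 / γ ^ 2 * Real.exp (γ / 4 * V) := by
    rw [div_mul_eq_mul_div, le_div_iff₀ (by positivity)]
    nlinarith [mul_nonneg hγ.le hV]
  calc V ^ 2 * Real.exp (-(3 / 4 * γ * V))
      ≤ 32 / γ ^ 2 * Real.exp (γ / 4 * V) * Real.exp (-(3 / 4 * γ * V)) := by gcongr
    _ = 32 / γ ^ 2 * Real.exp (-(γ / 2 * V)) := by
        rw [mul_assoc, ← Real.exp_add]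
        ring_nf

theorem exists_exponential_bound (hd : 1 ≤ d) {μ lam : ℝ≥0} (hμ : 0 < μ) (hμ' : μ < 1)
    (hlam : 0 < lam)
    (h : 2 * d * (2 * (d : ℝ) * (lam : ℝ)) ^ (μ : ℝ) <
      (μ : ℝ) ^ (μ : ℝ) * (1 - (μ : ℝ)) ^ (1 - (μ : ℝ))) :
    ∃ c C b : ℝ, 0 < c ∧ 0 < C ∧ 0 < b ∧ ∀ (n : ℕ) [NeZero n],
      arwLaw d n μ lam {ω | fixationTime lam ω < ENNReal.ofReal (Real.exp (c * (n : ℝ) ^ d))} ≤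
        ENNReal.ofReal (C * Real.exp (-(b * (n : ℝ) ^ d))) := by
  have hμ₁ : (μ : ℝ) < 1 := by exact_mod_cast hμ'
  have hμ₀ : (0 : ℝ) < μ := hμ
  have hlam₀ : (0 : ℝ) < lam := hlam
  obtain ⟨ε, hε, hεμ, ρ, hρ, hρ1, hent⟩ := exists_entropy_bound hd hμ₀ hμ₁ hlam₀ h
  obtain ⟨α, hα, hpoi⟩ := exists_poisson_rate hμ₀ hμ₁ hε
  set γ := -Real.log ρ with hγ
  have hγ0 : 0 < γ := neg_pos.2 (Real.log_neg hρ hρ1)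
  set C₁ : ℝ := 2 * (1 + lam) + 4 with hC₁
  have hC₁0 : 0 < C₁ := by positivity
  -- The union over `k ≤ K` and the factor `k` in each bound cost about `K ^ 2`, of order `V ^ 2 *
  -- exp (γ / 4 * V)` for time `exp (γ / 8 * V)`. Against `exp (-(γ * V))`, a decay of rate `γ / 2`
  -- remains once `V ^ 2` is absorbed.
  refine ⟨γ / 8, 1 + C₁ ^ 2 * (lam : ℝ)⁻¹ * (32 / γ ^ 2) + 1, min (min α (γ / 2)) 1, by positivity,
    by positivity, by positivity, fun n _ => ?_⟩
  set b := min (min α (γ / 2)) 1 with hb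
  have hn : (1 : ℝ) ≤ n := by exact_mod_cast NeZero.one_le
  set V : ℝ := (n : ℝ) ^ d with hV
  have hV1 : 1 ≤ V := one_le_pow₀ hn
  set τ : ℝ := Real.exp (γ / 8 * V) with hτ
  have hτ1 : 1 ≤ τ := Real.one_le_exp (by positivity)
  set M : ℝ := τ * ((1 + lam) * V) with hM
  have hM0 : 0 ≤ M := by positivity
  set K : ℕ := ⌈2 * (M + V)⌉₊ with hK
  have hKle : (K : ℝ) + 1 ≤ C₁ * (V * τ) := by
    have h₁ := Nat.ceil_lt_add_one (show 0 ≤ 2 * (M + V) by positivity)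
    have h₂ : V ≤ V * τ := le_mul_of_one_le_right (by positivity) hτ1
    rw [hC₁]
    nlinarith
  set B : ℝ := K * ((lam : ℝ)⁻¹ * Real.exp (-(γ * V))) with hB
  have hρV : ρ ^ n ^ d = Real.exp (-(γ * V)) := by
    rw [hγ, neg_mul, neg_neg, mul_comm, hV, show ((n : ℝ) ^ d) = ((n ^ d : ℕ) : ℝ) by push_cast; rfl,
      Real.exp_nat_mul, Real.exp_log hρ]
  have hm : 0 < ((μ : ℝ) - ε) * V := mul_pos (by linarith) (by linarith)
  have hmain := arwLaw_fixationTime_lt_le (d := d) (n := n) hd μ hlam (m := (μ - ε) * V) (B := B)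
    (τ := τ) hm (by positivity) K (fun k hk N hN => by
      have hN0 : 0 < N := by exact_mod_cast hm.trans_le hN
      have := hent (n ^ d) N hN0 (by push_cast; exact hN)
      rw [hρV] at this
      calc ((n ^ d).choose N : ℝ) * (k * ((2 * d) ^ n ^ d * (lam : ℝ) ^ (N - 1)))
          = k * ((n ^ d).choose N * ((2 * d) ^ n ^ d * (lam : ℝ) ^ (N - 1))) := by ring
        _ ≤ B := by rw [hB]; gcongr)
  have hexp : ∀ a, b ≤ a → Real.exp (-(a * V)) ≤ Real.exp (-(b * V)) := fun a ha =>
    Real.exp_le_exp.2 (neg_le_neg (mul_le_mul_of_nonneg_right ha (by positivity)))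
  have hbα : b ≤ α := (min_le_left _ _).trans (min_le_left _ _)
  have hbγ : b ≤ γ / 2 := (min_le_left _ _).trans (min_le_right _ _)
  have hb1 : b ≤ 1 := min_le_right _ _
  have h₁ : initialLaw d n μ {η | (total η : ℝ) < (μ - ε) * V} ≤
      ENNReal.ofReal (Real.exp (-(b * V))) := by
    refine (initialLaw_total_lt_le μ hε.le _).trans
      (ENNReal.ofReal_le_ofReal ((Real.exp_le_exp.2 ?_).trans (hexp α hbα)))
    calc ε * ((μ - ε) * V) + (n : ℝ) ^ d * (μ * (Real.exp (-ε) - 1))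
        = (ε * (μ - ε) + μ * (Real.exp (-ε) - 1)) * V := by rw [hV]; ring
      _ ≤ -α * V := by gcongr
      _ = -(α * V) := by ring
  have h₂ : ((K : ℝ≥0∞) + 1) * ENNReal.ofReal B ≤
      ENNReal.ofReal (C₁ ^ 2 * (lam : ℝ)⁻¹ * (32 / γ ^ 2) * Real.exp (-(b * V))) := by
    have : ((K : ℝ≥0∞) + 1) = ENNReal.ofReal ((K : ℝ) + 1) := by
      rw [ENNReal.ofReal_add (Nat.cast_nonneg K) zero_le_one, ENNReal.ofReal_natCast, ENNReal.ofReal_one]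
    rw [this, ← ENNReal.ofReal_mul (by positivity)]
    refine ENNReal.ofReal_le_ofReal ?_
    have hττ : τ ^ 2 * Real.exp (-(γ * V)) = Real.exp (-(3 / 4 * γ * V)) := by
      rw [hτ, ← Real.exp_nat_mul, ← Real.exp_add]
      congr 1
      push_cast
      ring
    calc ((K : ℝ) + 1) * B
        ≤ ((K : ℝ) + 1) * (((K : ℝ) + 1) * ((lam : ℝ)⁻¹ * Real.exp (-(γ * V)))) := by
          rw [hB]
          gcongr
          linarith
      _ ≤ (C₁ * (V * τ)) * ((C₁ * (V * τ)) * ((lam : ℝ)⁻¹ * Real.exp (-(γ * V)))) := by gcongr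
      _ = C₁ ^ 2 * (lam : ℝ)⁻¹ * (V ^ 2 * (τ ^ 2 * Real.exp (-(γ * V)))) := by ring
      _ ≤ C₁ ^ 2 * (lam : ℝ)⁻¹ * (32 / γ ^ 2 * Real.exp (-(γ / 2 * V))) := by
          rw [hττ]
          exact mul_le_mul_of_nonneg_left (sq_mul_exp_le hγ0 (zero_le_one.trans hV1))
            (by positivity)
      _ ≤ C₁ ^ 2 * (lam : ℝ)⁻¹ * (32 / γ ^ 2 * Real.exp (-(b * V))) := by
          gcongr
      _ = _ := by ring
  have h₃ : ENNReal.ofReal (Real.exp M * (1 / 2) ^ K) ≤ ENNReal.ofReal (Real.exp (-(b * V))) := by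
    refine ENNReal.ofReal_le_ofReal ((exp_mul_half_pow_le (V := V) (Nat.le_ceil _)).trans ?_)
    simpa using hexp 1 hb1
  refine (hmain.trans (add_le_add (add_le_add h₁ h₂) h₃)).trans_eq ?_
  rw [← ENNReal.ofReal_add (by positivity) (by positivity),
    ← ENNReal.ofReal_add (by positivity) (by positivity)]
  congr 1
  ring

/-- For each fixed size, the fixation time is infinite with positive probability. -/
lemma exists_rate_of_size (hd : 1 ≤ d) {μ : ℝ≥0} (hμ : 0 < μ) (lam : ℝ≥0) (n : ℕ) :
    ∃ c₀ : ℝ, 0 < c₀ ∧ ∀ [NeZero n], ∀ c ≤ c₀, ∀ t : ℝ≥0∞,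
      arwLaw d n μ lam {ω | fixationTime lam ω < t} <
        ENNReal.ofReal (Real.exp (-(c * (n : ℝ) ^ d))) := by
  -- For `n = 0` the claim is vacuous and the constant is arbitrary; it only makes the rate defined
  -- for every `n`.
  rcases Nat.eq_zero_or_pos n with rfl | hn
  · exact ⟨1, one_pos, fun {h} => absurd rfl h.out⟩
  have : NeZero n := ⟨hn.ne'⟩
  have hq := initialLaw_total_le_lt_one (d := d) (n := n) hμ
  set q := initialLaw d n μ {η | total η ≤ n ^ d}
  have hq' : q.toReal < 1 := by
    rw [← ENNReal.toReal_one]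
    exact (ENNReal.toReal_lt_toReal hq.ne_top ENNReal.one_ne_top).2 hq
  have hq0 : 0 ≤ q.toReal := ENNReal.toReal_nonneg
  have hV : 0 < (n : ℝ) ^ d := by positivity
  refine ⟨-Real.log ((q.toReal + 1) / 2) / (n : ℝ) ^ d,
    div_pos (neg_pos.2 (Real.log_neg (by linarith) (by linarith))) hV, fun {_} c hc t => ?_⟩
  refine (arwLaw_fixationTime_lt_le_initialLaw hd μ lam t).trans_lt ?_
  rw [ENNReal.lt_ofReal_iff_toReal_lt hq.ne_top]
  rw [le_div_iff₀ hV] at hc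
  calc q.toReal < (q.toReal + 1) / 2 := by linarith
    _ = Real.exp (Real.log ((q.toReal + 1) / 2)) := (Real.exp_log (by linarith)).symm
    _ ≤ _ := Real.exp_le_exp.2 (by linarith)

end ARW

theorem theorem3 (d : ℕ) (hd : 1 ≤ d) :
    ∃ κ : ℝ, 0 < κ ∧
      ∀ μ lam : ℝ≥0, 0 < μ → μ < 1 → 0 < lam →
        κ * (2 * (d : ℝ) * (lam : ℝ)) ^ (μ : ℝ) <
          (μ : ℝ) ^ (μ : ℝ) * (1 - (μ : ℝ)) ^ (1 - (μ : ℝ)) →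
        ∃ c : ℝ, 0 < c ∧ ∀ (n : ℕ) [NeZero n],
          ARW.arwLaw d n μ lam
              {ω | ARW.fixationTime lam ω < ENNReal.ofReal (Real.exp (c * (n : ℝ) ^ d))} <
            ENNReal.ofReal (Real.exp (-(c * (n : ℝ) ^ d))) := by
  -- The constant `2 * d` comes from the factor `(2d)^(n^d)` in the bound on `settle`.
  refine ⟨2 * d, by positivity, fun μ lam hμ hμ' hlam h => ?_⟩
  obtain ⟨c₁, C, b, hc₁, hC, hb, hbound⟩ := ARW.exists_exponential_bound hd hμ hμ' hlam h
  choose c₂ hc₂ hsmall using ARW.exists_rate_of_size hd hμ lam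
  -- Beyond `n₀` the prefactor `C` is absorbed by half of the exponent `b`; the finitely many
  -- smaller sizes use their own rates `c₂ n`.
  set n₀ : ℕ := ⌈2 * C / b⌉₊ with hn₀
  have hne : (Finset.range (n₀ + 1)).Nonempty := ⟨0, by simp⟩
  set c₃ := (Finset.range (n₀ + 1)).inf' hne c₂ with hc₃
  have hc₃0 : 0 < c₃ := (Finset.lt_inf'_iff hne).2 fun n _ => hc₂ n
  refine ⟨min (min c₁ (b / 2)) c₃, by positivity, fun n _ => ?_⟩
  set c := min (min c₁ (b / 2)) c₃ with hc
  have hcc₁ : c ≤ c₁ := (min_le_left _ _).trans (min_le_left _ _)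
  have hcb : c ≤ b / 2 := (min_le_left _ _).trans (min_le_right _ _)
  have hn1 : (1 : ℝ) ≤ n := by exact_mod_cast NeZero.one_le
  have hV : (n : ℝ) ≤ (n : ℝ) ^ d := le_self_pow₀ hn1 (by omega)
  have hV0 : 0 < (n : ℝ) ^ d := by positivity
  rcases Nat.lt_or_ge n (n₀ + 1) with hn | hn
  · exact hsmall n c ((min_le_right _ _).trans (Finset.inf'_le _ (Finset.mem_range.2 hn))) _
  · have hsub : {ω | ARW.fixationTime (d := d) (n := n) lam ω <
        ENNReal.ofReal (Real.exp (c * (n : ℝ) ^ d))} ⊆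
        {ω | ARW.fixationTime lam ω < ENNReal.ofReal (Real.exp (c₁ * (n : ℝ) ^ d))} :=
      fun ω hω => lt_of_lt_of_le hω (ENNReal.ofReal_le_ofReal (Real.exp_le_exp.2 (by gcongr)))
    refine ((measure_mono hsub).trans (hbound n)).trans_lt ?_
    rw [ENNReal.ofReal_lt_ofReal_iff (Real.exp_pos _)]
    have hCb : C ≤ b / 2 * (n : ℝ) ^ d := by
      have h₁ : 2 * C / b ≤ n := (Nat.le_ceil _).trans (by exact_mod_cast (Nat.le_succ n₀).trans hn)
      rw [div_le_iff₀ hb] at h₁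
      nlinarith
    have hCexp : C < Real.exp (b / 2 * (n : ℝ) ^ d) := by
      linarith [Real.add_one_le_exp (b / 2 * (n : ℝ) ^ d)]
    calc C * Real.exp (-(b * (n : ℝ) ^ d))
        < Real.exp (b / 2 * (n : ℝ) ^ d) * Real.exp (-(b * (n : ℝ) ^ d)) := by gcongr
      _ = Real.exp (-(b / 2 * (n : ℝ) ^ d)) := by
          rw [← Real.exp_add]
          ring_nf
      _ ≤ Real.exp (-(c * (n : ℝ) ^ d)) := Real.exp_le_exp.2 (by gcongr)
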